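/- An \emph{orthoscheme} is a Euclidean simplex with totally ordered vertices $p_0,\dots,p_m$ whose edge vectors $p_1-p_0,\dots,p_m-p_{m-1}$ are pairwise orthogonal. An \emph{orthoscheme complex} is a $\Delta$-complex whose simplices are orthoschemes, glued by order-preserving isometries; it carries the length pseudometric (infimum of lengths of piecewise affine paths, $\infty$ if there are none). An \emph{isomorphism} of orthoscheme complexes is a homeomorphism identifying the simplices together with their vertex orders and metrics. The real line is an orthoscheme complex with vertex set $\mathbb{Z}$ and unit edges directed from $a$ to $a+1$; the oriented $n$-cycle $\Gamma_n=\mathbb{R}/n\mathbb{Z}$ is its quotient. The product of $k$ orthoscheme complexes is again an orthoscheme complex: each product of closed simplices is subdivided into the simplices spanned by the chains of its vertices in the product order, with the product metric. For $0<k\le n$ let $\mathrm{Conf}_k(\Gamma_n)$ be the subcomplex of the $k$-fold product of $\Gamma_n$ consisting of the closed simplices disjoint from the thick diagonal $\{x : x_i=x_j \text{ for some } i\ne j\}$, and let $\mathrm{UConf}_k(\Gamma_n)=\mathrm{Conf}_k(\Gamma_n)/\mathrm{Sym}_k$. The \emph{$(k,n)$-dilated column} is the full subcomplex of the $k$-fold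 product $\mathbb{R}^k$ of the line spanned by the vertices $x\in\mathbb{Z}^k$ with $x_1<x_2<\dots<x_k<x_1+n$. A \emph{universal cover} of a possibly disconnected space is a covering map whose restriction over each connected component is a simply connected covering space of that component; a universal cover of $\mathrm{Conf}_k(\Gamma_n)$ inherits the structure of an orthoscheme complex whose simplices are the lifts of the simplices of $\mathrm{Conf}_k(\Gamma_n)$. \textbf{Proposition.} Let $0<k\le n$. The $(k,n)$-dilated column, $\mathrm{Conf}_k(\Gamma_n)$ and $\mathrm{UConf}_k(\Gamma_n)$ are orthoscheme complexes, and $\mathrm{Conf}_k(\Gamma_n)$ has a universal cover. Each connected component of any universal cover of $\mathrm{Conf}_k(\Gamma_n)$ is isomorphic, as an orthoscheme complex, to the $(k,n)$-dilated column, and the component and the column are $\mathrm{CAT}(0)$ with respect to their length metrics. Consequently $\mathrm{Conf}_k(\Gamma_n)$ and $\mathrm{UConf}_k(\Gamma_n)$ are non-positively curved: their length pseudometrics are metrics (possibly with infinite distances), and every point is the centre of a ball of positive radius that is $\mathrm{CAT}(0)$ in the induced metric. -/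

import Mathlib

open scoped ENNReal

universe u v

/-- A map of an ordered `m`-simplex, in barycentric coordinates, to a set `K`, where the simplex
carries the metric of the orthoscheme whose ordered orthogonal basis `v₁, …, vₘ`
(`vᵢ = pᵢ - pᵢ₋₁`) has the lengths `len`. -/
@[ext]
structure OrthoCell (K : Type u) (m : ℕ) where
  toFun : stdSimplex ℝ (Fin (m + 1)) → K
  len : Fin m → ℝ

/-- The point with barycentric coordinates `t` in the orthoscheme
`p₀ = 0, pⱼ = w₀ e₀ + ⋯ + wⱼ₋₁ eⱼ₋₁`; its `i`-th coordinate is `wᵢ * ∑_{j > i} tⱼ`. -/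
noncomputable def orthoPoint {m : ℕ} (w : Fin m → ℝ) (t : stdSimplex ℝ (Fin (m + 1))) :
    EuclideanSpace ℝ (Fin m) :=
  WithLp.toLp 2 (fun i => w i * ∑ j : Fin (m + 1) with i.castSucc < j, t j)

namespace OrthoCell

variable {K : Type u} {L : Type v} {m n : ℕ}

/-- Euclidean distance inside the orthoscheme. -/
noncomputable def dist (σ : OrthoCell K m) (a b : stdSimplex ℝ (Fin (m + 1))) : ℝ :=
  Dist.dist (orthoPoint σ.len a) (orthoPoint σ.len b)

/-- The squared length of the edge from vertex `a` to vertex `b`, for `a ≤ b`. -/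
noncomputable def normSq (σ : OrthoCell K m) (a b : Fin (m + 1)) : ℝ :=
  ∑ l : Fin m with a ≤ l.castSucc ∧ l.castSucc < b, σ.len l ^ 2

/-- Postcomposition with a map of sets; the metric on the simplex is unchanged. -/
def map (f : K → L) (σ : OrthoCell K m) : OrthoCell L m :=
  ⟨fun t => f (σ.toFun t), σ.len⟩

/-- The face of `σ` spanned by the vertices `f 0 < ⋯ < f m`, with the induced order and metric. -/
noncomputable def face (σ : OrthoCell K n) (f : Fin (m + 1) ↪o Fin (n + 1)) : OrthoCell K m :=
  ⟨fun t => σ.toFun (stdSimplex.map f t),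
   fun j => Real.sqrt (σ.normSq (f j.castSucc) (f j.succ))⟩

/-- The image in `K` of the `j`-th vertex. -/
noncomputable def vertex (σ : OrthoCell K m) (j : Fin (m + 1)) : K :=
  σ.toFun (stdSimplex.vertex j)

/-- Given simplices `σ i` of dimension `d i` and a chain `c 0, …, c m` of vertices of their
product, the simplex spanned by that chain in the product of the `σ i`, with the metric induced
from the Euclidean product metric. -/
noncomputable def prod {ι : Type} [Fintype ι] {d : ι → ℕ} (σ : ∀ i, OrthoCell K (d i))
    (c : Fin (m + 1) → ∀ i, Fin (d i + 1)) : OrthoCell (ι → K) m :=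
  ⟨fun t i => (σ i).toFun (stdSimplex.map (fun j => c j i) t),
   fun j => Real.sqrt (∑ i, (σ i).normSq (c j.castSucc i) (c j.succ i))⟩

end OrthoCell

/-- A family of metric ordered simplices in a set `K`, listed by dimension. -/
@[ext]
structure OrthoSystem (K : Type u) where
  cells : ∀ m : ℕ, Set (OrthoCell K m)

namespace OrthoSystem

variable {K : Type u} {L : Type v}

/-- The family of simplices makes `K` an orthoscheme complex: `K` is a `Δ`-complex with these
characteristic maps, each simplex has the metric of an orthoscheme, and the identifications of
simplices (with faces of other simplices, and with each other) are isometries.  Recall that an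
isomorphism of ordered simplices is unique: it is the identity in barycentric coordinates. -/
structure IsOrthoschemeComplex (S : OrthoSystem K) : Prop where
  len_pos : ∀ m, ∀ σ ∈ S.cells m, ∀ i, 0 < σ.len i
  covers : ∀ x : K, ∃ m, ∃ σ ∈ S.cells m, x ∈ Set.range σ.toFun
  injOn_interior : ∀ m, ∀ σ ∈ S.cells m, Set.InjOn σ.toFun {t | ∀ j, 0 < t j}
  face_mem : ∀ m n, ∀ σ ∈ S.cells n, ∀ f : Fin (m + 1) ↪o Fin (n + 1), σ.face f ∈ S.cells m
  eq_of_interior : ∀ m m', ∀ σ ∈ S.cells m, ∀ σ' ∈ S.cells m',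
    ∀ t : stdSimplex ℝ (Fin (m + 1)), ∀ t' : stdSimplex ℝ (Fin (m' + 1)),
      (∀ j, 0 < t j) → (∀ j, 0 < t' j) → σ.toFun t = σ'.toFun t' →
        (⟨m, σ⟩ : Σ m, OrthoCell K m) = ⟨m', σ'⟩

/-- `S.HasPath x y ℓ`: there is a piecewise affine path of length `ℓ` from `x` to `y`, i.e. a
finite concatenation of straight segments, each contained in a closed simplex. -/
inductive HasPath (S : OrthoSystem K) : K → K → ℝ → Prop
  | refl (x : K) : HasPath S x x 0
  | step {x : K} {ℓ : ℝ} {m : ℕ} (σ : OrthoCell K m) (hσ : σ ∈ S.cells m)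
      (a b : stdSimplex ℝ (Fin (m + 1))) (h : HasPath S x (σ.toFun a) ℓ) :
      HasPath S x (σ.toFun b) (ℓ + σ.dist a b)

/-- The length pseudometric; it is `∞` when there is no piecewise affine path. -/
noncomputable def edist (S : OrthoSystem K) (x y : K) : ℝ≥0∞ :=
  ⨅ (ℓ : ℝ) (_ : S.HasPath x y ℓ), ENNReal.ofReal ℓ

/-- The image of a family of simplices under a map of sets. -/
def map (f : K → L) (S : OrthoSystem K) : OrthoSystem L :=
  ⟨fun m => OrthoCell.map f '' S.cells m⟩

/-- The simplices that are contained in a subset. -/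
def restrict (S : OrthoSystem K) (A : Set K) : OrthoSystem A :=
  ⟨fun m => {σ | σ.map Subtype.val ∈ S.cells m}⟩

/-- The union of the closed simplices with the property `P`. -/
def support (S : OrthoSystem K) (P : ∀ m, OrthoCell K m → Prop) : Set K :=
  {x | ∃ m, ∃ σ ∈ S.cells m, P m σ ∧ x ∈ Set.range σ.toFun}

/-- The subcomplex consisting of the simplices with the property `P`, for a property `P` that is
inherited by faces. -/
def sub (S : OrthoSystem K) (P : ∀ m, OrthoCell K m → Prop) : OrthoSystem (S.support P) :=
  ⟨fun m => {σ | σ.map Subtype.val ∈ S.cells m ∧ P m (σ.map Subtype.val)}⟩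

/-- The structure on a covering space `E` of `K`: its simplices are the lifts of simplices. -/
def lift [TopologicalSpace L] (S : OrthoSystem K) (q : L → K) : OrthoSystem L :=
  ⟨fun m => {σ | Continuous σ.toFun ∧ σ.map q ∈ S.cells m}⟩

/-- The product of `k` copies of `K`: each product of closed simplices is subdivided into the
simplices spanned by the chains of its vertices in the product order. -/
def prod (k : ℕ) (S : OrthoSystem K) : OrthoSystem (Fin k → K) :=
  ⟨fun m => {ρ | ∃ (d : Fin k → ℕ) (σ : ∀ i, OrthoCell K (d i))
    (c : Fin (m + 1) → ∀ i, Fin (d i + 1)),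
      (∀ i, σ i ∈ S.cells (d i)) ∧ StrictMono c ∧ ρ = OrthoCell.prod σ c}⟩

/-- `S` and `T` are isomorphic as orthoscheme complexes: there is a homeomorphism that
identifies the simplices, with their vertex orders and metrics. -/
def IsIsomorphic [TopologicalSpace K] [TopologicalSpace L] (S : OrthoSystem K)
    (T : OrthoSystem L) : Prop :=
  ∃ e : K ≃ₜ L, ∀ m (σ : OrthoCell K m), σ ∈ S.cells m ↔ σ.map e ∈ T.cells m

end OrthoSystem

/-! ### Configuration spaces -/

/-- The thick diagonal: tuples with two equal entries. -/
def thickDiag (k : ℕ) (K : Type u) : Set (Fin k → K) :=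
  {x | ∃ i j, i ≠ j ∧ x i = x j}

/-- The simplex is disjoint from the thick diagonal. -/
def AvoidsDiag {K : Type u} (k m : ℕ) (σ : OrthoCell (Fin k → K) m) : Prop :=
  Disjoint (Set.range σ.toFun) (thickDiag k K)

/-- The underlying space of the orthoscheme configuration space of `k` labeled points. -/
abbrev ConfSpace {K : Type u} (k : ℕ) (S : OrthoSystem K) : Type u :=
  (S.prod k).support (AvoidsDiag k)

/-- The orthoscheme configuration space of `k` labeled points: the closed simplices of the product
that are disjoint from the thick diagonal. -/
def conf {K : Type u} (k : ℕ) (S : OrthoSystem K) : OrthoSystem (ConfSpace k S) :=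
  (S.prod k).sub (AvoidsDiag k)

/-- Two labeled configurations differ by a permutation of the labels. -/
def confSetoid {K : Type u} (k : ℕ) (S : OrthoSystem K) : Setoid (ConfSpace k S) where
  r x y := ∃ π : Equiv.Perm (Fin k), y.1 = x.1 ∘ π
  iseqv :=
    { refl := fun _ => ⟨1, rfl⟩
      symm := by
        rintro x y ⟨π, h⟩
        refine ⟨π.symm, ?_⟩
        funext i
        simp [h]
      trans := by
        rintro x y z ⟨π, h⟩ ⟨ρ, h'⟩
        refine ⟨ρ.trans π, ?_⟩
        funext i
        simp [h, h'] }

/-- The orthoscheme configuration space of `k` unlabeled points: the quotient of the labeled one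
by the symmetric group. -/
def uconf {K : Type u} (k : ℕ) (S : OrthoSystem K) :
    OrthoSystem (Quotient (confSetoid k S)) :=
  (conf k S).map (Quotient.mk (confSetoid k S))

/-! ### The line, the oriented cycles and the dilated columns -/

/-- The real line with vertex set `ℤ` and a unit edge from `a` to `a + 1` for each integer `a`. -/
def line : OrthoSystem ℝ :=
  ⟨fun m => match m with
    | 0 => {σ | ∃ a : ℤ, σ = ⟨fun _ => (a : ℝ), fun _ => 1⟩}
    | 1 => {σ | ∃ a : ℤ, σ = ⟨fun t => (a : ℝ) + t 1, fun _ => 1⟩}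
    | _ => ∅⟩

/-- The oriented `n`-cycle `ℝ / nℤ`. -/
def cycle (n : ℕ) : OrthoSystem (AddCircle (n : ℝ)) :=
  line.map (fun x : ℝ => (x : AddCircle (n : ℝ)))

/-- All vertices of the simplex satisfy `x₁ < x₂ < ⋯ < xₖ < x₁ + n`. -/
def InColumn (k n m : ℕ) (σ : OrthoCell (Fin k → ℝ) m) : Prop :=
  ∀ j, StrictMono (σ.vertex j) ∧ ∀ a b, σ.vertex j b < σ.vertex j a + n

/-- The underlying space of the `(k, n)`-dilated column. -/
abbrev ColumnSpace (k n : ℕ) : Type :=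
  (line.prod k).support (InColumn k n)

/-- The `(k, n)`-dilated column: the full subcomplex of the orthoscheme tiling of `ℝᵏ` (the
product of `k` copies of the line) on the vertices with `x₁ < x₂ < ⋯ < xₖ < x₁ + n`. -/
def column (k n : ℕ) : OrthoSystem (ColumnSpace k n) :=
  (line.prod k).sub (InColumn k n)

/-! ### Universal covers -/

/-- A universal cover of a possibly disconnected space: a covering map that restricts, over each
component of the base, to a simply connected covering space of that component. -/
def IsUniversalCover {E : Type u} {X : Type v} [TopologicalSpace E] [TopologicalSpace X]
    (q : E → X) : Prop :=
  IsCoveringMap q ∧ ∀ x : X, SimplyConnectedSpace (q ⁻¹' connectedComponent x)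

/-! ### Nonpositive curvature -/

/-- `d` is a metric, possibly with infinite distances. -/
structure IsExtMetric {X : Type u} (d : X → X → ℝ≥0∞) : Prop where
  eq_iff : ∀ x y, d x y = 0 ↔ x = y
  symm : ∀ x y, d x y = d y x
  triangle : ∀ x y z, d x z ≤ d x y + d y z

/-- `γ` is a geodesic from `x` to `y`, parametrized proportionally to arc length. -/
def IsGeodesic {X : Type u} (d : X → X → ℝ≥0∞) (x y : X) (γ : unitInterval → X) : Prop :=
  γ 0 = x ∧ γ 1 = y ∧ ∀ s t, d (γ s) (γ t) = ENNReal.ofReal |(s : ℝ) - t| * d x y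

/-- `(X, d)` is a `CAT(0)` space: a geodesic metric space in which distances between points on
two sides of a geodesic triangle are at most those in the Euclidean comparison triangle. -/
structure IsCAT0 {X : Type u} (d : X → X → ℝ≥0∞) : Prop where
  metric : IsExtMetric d
  finite : ∀ x y, d x y ≠ ∞
  geodesic : ∀ x y, ∃ γ, IsGeodesic d x y γ
  comparison : ∀ (x y z : X) (γ η : unitInterval → X), IsGeodesic d x y γ → IsGeodesic d x z η →
    ∀ x' y' z' : EuclideanSpace ℝ (Fin 2),
      EDist.edist x' y' = d x y → EDist.edist x' z' = d x z → EDist.edist y' z' = d y z →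
        ∀ s t : unitInterval, d (γ s) (η t) ≤
          EDist.edist (AffineMap.lineMap x' y' (s : ℝ) : EuclideanSpace ℝ (Fin 2))
            (AffineMap.lineMap x' z' (t : ℝ))

/-- `(X, d)` is non-positively curved: a metric space, possibly with infinite distances, in which
every point is the centre of a ball that is `CAT(0)` in the induced metric. -/
def IsNonpositivelyCurved {X : Type u} (d : X → X → ℝ≥0∞) : Prop :=
  IsExtMetric d ∧ ∀ x, ∃ r : ℝ, 0 < r ∧
    IsCAT0 (fun y z : {y : X // d x y < ENNReal.ofReal r} => d y.1 z.1)

/-! ### Barycentric sums -/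

section Barycentric

variable {m n : ℕ}

/-! Everything is computed in `ℝᵏ`. A simplex of a product of lines is a chain of vertices of a unit
cube. Each coordinate increases at most once along the chain, so the edges are orthogonal and the
orthoscheme metric is the Euclidean one (`IsLatticeChain.dist_eq`). The vertices of the simplex
carrying `x` are the coordinatewise floors of `x + s (1, …, 1)` for `0 ≤ s < 1`. Hence `x` is
interior to only one simplex, and integral bounds `c ≤ x i - x j` pass from `x` to all of that
simplex (`exists_latticeCell_apply_eq`). A polyhedron cut out by such bounds is therefore convex and
a union of simplices, so its length metric is Euclidean (`hasPath_of_mem_diffPolyhedron`). The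
column is one of these polyhedra.

The labeled configurations lift to the tuples whose differences `y i - y j` stay at distance at
least 1 from `nℤ`. These split into chambers according to the signs of `y i - y j - n N`. Each
chamber is again such a polyhedron, and separated tuples less than 1/2 apart share a chamber.
Piecewise affine paths downstairs lift into a chamber, and distinct tuples over one configuration,
labeled or not, are at least 1/2 apart. So small balls downstairs are isometric to convex Euclidean
sets, which gives nonpositive curvature (`isNonpositivelyCurved_of_path_lifting`).

A universal cover in the present sense needs a connected preimage of each component, while the full
set of lifts has many chambers over one component. Requiring all entries to lie in `[x, x + n)`,
where `x` is a chosen entry, leaves exactly one chamber, with only the diagonal translations by `nℤ`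
as deck transformations. Chambers are convex, hence contractible (`isUniversalCover_normProj`).
Sorting the coordinates turns a chamber into the column, and the lifting criterion compares every
other universal cover with this one. -/

theorem stdSimplex.sum_map_mul {X Y : Type*} [Fintype X] [Fintype Y] (f : X → Y)
    (t : stdSimplex ℝ X) (h : Y → ℝ) :
    ∑ y, stdSimplex.map f t y * h y = ∑ x, t x * h (f x) := by
  classical
  simp only [stdSimplex.map_coe, FunOnFinite.linearMap_apply_apply, Finset.sum_mul]
  rw [← Finset.sum_fiberwise Finset.univ f]
  refine Finset.sum_congr rfl fun y _ => Finset.sum_congr rfl fun x hx => ?_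
  rw [(Finset.mem_filter.1 hx).2]

theorem Fin.sum_filter_succ_sub_castSucc (h : Fin (m + 1) → ℝ) {a b : Fin (m + 1)}
    (hab : a ≤ b) :
    ∑ l : Fin m with a ≤ l.castSucc ∧ l.castSucc < b, (h l.succ - h l.castSucc) = h b - h a := by
  induction b using Fin.induction with
  | zero =>
    obtain rfl : a = 0 := le_antisymm hab (Fin.zero_le _)
    simp
  | succ j ih =>
    rcases hab.lt_or_eq with hlt | rfl
    · have haj : a ≤ j.castSucc := Fin.le_castSucc_iff.2 hlt
      have : (Finset.univ.filter fun l : Fin m => a ≤ l.castSucc ∧ l.castSucc < j.succ) =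
          insert j (Finset.univ.filter fun l : Fin m => a ≤ l.castSucc ∧ l.castSucc < j.castSucc) := by
        ext l
        simp only [Finset.mem_filter, Finset.mem_univ, true_and, Finset.mem_insert, Fin.le_def,
          Fin.lt_def, Fin.ext_iff, Fin.val_castSucc, Fin.val_succ] at haj ⊢
        omega
      rw [this, Finset.sum_insert (by simp), ih haj]
      ring
    · rw [Finset.sum_eq_zero, sub_self]
      intro l hl
      simp only [Finset.mem_filter, Finset.mem_univ, true_and, Fin.le_def,
          Fin.lt_def, Fin.val_castSucc, Fin.val_succ] at hl
      omega

/-- The sum of the barycentric coordinates after the `j`-th one. -/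
def tailSum (t : stdSimplex ℝ (Fin (m + 1))) (j : Fin m) : ℝ :=
  ∑ l : Fin (m + 1) with j.castSucc < l, t l

/-- Summation by parts. -/
theorem sum_mul_eq_add_sum_tailSum (t : stdSimplex ℝ (Fin (m + 1))) (h : Fin (m + 1) → ℝ) :
    ∑ l, t l * h l = h 0 + ∑ j : Fin m, (h j.succ - h j.castSucc) * tailSum t j := by
  have key (l : Fin (m + 1)) : h l = h 0 +
      ∑ j : Fin m, if j.castSucc < l then (h j.succ - h j.castSucc) else 0 := by
    have := Fin.sum_filter_succ_sub_castSucc h (Fin.zero_le l)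
    simp only [Fin.zero_le, true_and, Finset.sum_filter] at this
    rw [this]; ring
  calc ∑ l, t l * h l
      = ∑ l, t l * (h 0 + ∑ j : Fin m, if j.castSucc < l then (h j.succ - h j.castSucc) else 0) :=
        Finset.sum_congr rfl fun l _ => by rw [← key l]
    _ = _ := by
      simp only [mul_add, Finset.sum_add_distrib, ← Finset.sum_mul, stdSimplex.sum_eq_one, one_mul,
        Finset.mul_sum, tailSum, Finset.sum_filter]
      rw [Finset.sum_comm]
      congr 1
      refine Finset.sum_congr rfl fun j _ => Finset.sum_congr rfl fun l _ => ?_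
      split_ifs <;> ring

/-- Summation by parts against the indicator of `l` recovers the coordinate `t l` from the tail
sums, which are the orthoscheme coordinates up to the edge lengths. -/
theorem stdSimplex.eq_of_tailSum_eq {s t : stdSimplex ℝ (Fin (m + 1))}
    (h : ∀ j, tailSum s j = tailSum t j) : s = t := by
  ext l
  have hs := sum_mul_eq_add_sum_tailSum s (Pi.single l 1)
  have ht := sum_mul_eq_add_sum_tailSum t (Pi.single l 1)
  simp only [h] at hs
  rw [← ht] at hs
  simpa [Pi.single_apply] using hs

theorem orthoPoint_apply (w : Fin m → ℝ) (t : stdSimplex ℝ (Fin (m + 1))) (i : Fin m) :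
    orthoPoint w t i = w i * tailSum t i := rfl

end Barycentric

/-! ### Lattice simplices -/

section Lattice

variable {k m n : ℕ}

/-- The simplex in `ℝᵏ` spanned by integer points `v 0, …, v m`, with the metric of the orthoscheme
whose `j`-th edge has squared length the sum of the coordinates of `v (j + 1) - v j`. -/
noncomputable def latticeCell (v : Fin (m + 1) → Fin k → ℤ) : OrthoCell (Fin k → ℝ) m :=
  ⟨fun t i => ∑ j, t j * (v j i : ℝ),
   fun j => Real.sqrt (∑ i, ((v j.succ i : ℝ) - v j.castSucc i))⟩

/-- A chain of vertices of a unit cube. -/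
structure IsLatticeChain (v : Fin (m + 1) → Fin k → ℤ) : Prop where
  strictMono : StrictMono v
  last_le : ∀ i, v (Fin.last m) i ≤ v 0 i + 1

namespace IsLatticeChain

variable {v : Fin (m + 1) → Fin k → ℤ}

theorem mono (hv : IsLatticeChain v) {a b : Fin (m + 1)} (h : a ≤ b) (i : Fin k) :
    v a i ≤ v b i := hv.strictMono.monotone h i

theorem zero_le (hv : IsLatticeChain v) (a : Fin (m + 1)) (i : Fin k) : v 0 i ≤ v a i :=
  hv.mono (Fin.zero_le _) i

theorem le_add_one (hv : IsLatticeChain v) (a b : Fin (m + 1)) (i : Fin k) :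
    v b i ≤ v a i + 1 :=
  (hv.mono (Fin.le_last b) i).trans ((hv.last_le i).trans (by linarith [hv.zero_le a i]))

theorem comp (hv : IsLatticeChain v) (f : Fin (n + 1) ↪o Fin (m + 1)) :
    IsLatticeChain (fun j => v (f j)) :=
  ⟨fun _ _ h => hv.strictMono (f.strictMono h), fun _ => hv.le_add_one _ _ _⟩

/-- Permuting the coordinates and translating. -/
theorem transform (hv : IsLatticeChain v) (π : Equiv.Perm (Fin k)) (N : Fin k → ℤ) :
    IsLatticeChain (fun j i => v j (π i) + N i) := by
  refine ⟨fun a b h => ?_, fun i => by linarith [hv.last_le (π i)]⟩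
  have h' := hv.strictMono h
  rw [Pi.lt_def] at h' ⊢
  obtain ⟨h1, i, hi⟩ := h'
  exact ⟨fun i => by have := h1 (π i); simpa using this, π.symm i, by simpa using hi⟩

end IsLatticeChain

theorem latticeCell_apply (v : Fin (m + 1) → Fin k → ℤ) (t) (i) :
    (latticeCell v).toFun t i = ∑ j, t j * (v j i : ℝ) := rfl

theorem latticeCell_apply_eq (v : Fin (m + 1) → Fin k → ℤ) (t) (i) :
    (latticeCell v).toFun t i =
      v 0 i + ∑ j : Fin m, ((v j.succ i : ℝ) - v j.castSucc i) * tailSum t j :=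
  sum_mul_eq_add_sum_tailSum t (fun j => (v j i : ℝ))

theorem latticeCell_vertex (v : Fin (m + 1) → Fin k → ℤ) (j) :
    (latticeCell v).vertex j = fun i => (v j i : ℝ) := by
  funext i
  simp [OrthoCell.vertex, latticeCell_apply, Pi.single_apply]

theorem continuous_latticeCell (v : Fin (m + 1) → Fin k → ℤ) :
    Continuous (latticeCell v).toFun := by
  refine continuous_pi fun i => ?_
  change Continuous fun t : stdSimplex ℝ (Fin (m + 1)) => ∑ j, t j * (v j i : ℝ)
  have h (j : Fin (m + 1)) : Continuous fun t : stdSimplex ℝ (Fin (m + 1)) => t j * (v j i : ℝ) :=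
    ((continuous_apply j).comp continuous_subtype_val).mul continuous_const
  exact continuous_finsetSum _ fun j _ => h j

theorem latticeCell_transform_apply (v : Fin (m + 1) → Fin k → ℤ) (π : Equiv.Perm (Fin k))
    (N : Fin k → ℤ) (t) (i) :
    (latticeCell fun j i => v j (π i) + N i).toFun t i = (latticeCell v).toFun t (π i) + N i := by
  simp [latticeCell_apply, mul_add, Finset.sum_add_distrib, ← Finset.sum_mul]

theorem latticeCell_transform_len (v : Fin (m + 1) → Fin k → ℤ) (π : Equiv.Perm (Fin k))
    (N : Fin k → ℤ) :
    (latticeCell fun j i => v j (π i) + N i).len = (latticeCell v).len := by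
  funext j
  simp only [latticeCell]
  congr 1
  rw [← Equiv.sum_comp π (fun i => (v j.succ i : ℝ) - v j.castSucc i)]
  simp

theorem IsLatticeChain.sum_nonneg {v : Fin (m + 1) → Fin k → ℤ} (hv : IsLatticeChain v)
    {a b : Fin (m + 1)} (h : a ≤ b) : 0 ≤ ∑ i, ((v b i : ℝ) - v a i) :=
  Finset.sum_nonneg fun i _ => sub_nonneg.2 (by exact_mod_cast hv.mono h i)

theorem IsLatticeChain.len_pos {v : Fin (m + 1) → Fin k → ℤ} (hv : IsLatticeChain v) (j : Fin m) :
    0 < (latticeCell v).len j := by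
  refine Real.sqrt_pos.2 ?_
  have h := Pi.lt_def.1 (hv.strictMono (Fin.castSucc_lt_succ (i := j)))
  obtain ⟨h1, i, hi⟩ := h
  refine Finset.sum_pos' (fun i _ => sub_nonneg.2 (by exact_mod_cast h1 i)) ⟨i, Finset.mem_univ _, ?_⟩
  exact sub_pos.2 (by exact_mod_cast hi)

/-- Edge vectors of a chain have entries 0 and 1, so squared lengths are plain coordinate sums, and
these telescope. -/
theorem IsLatticeChain.normSq {v : Fin (m + 1) → Fin k → ℤ} (hv : IsLatticeChain v)
    {a b : Fin (m + 1)} (h : a ≤ b) :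
    (latticeCell v).normSq a b = ∑ i, ((v b i : ℝ) - v a i) := by
  rw [OrthoCell.normSq]
  have : ∀ l : Fin m, (latticeCell v).len l ^ 2 =
      (∑ i, (v l.succ i : ℝ)) - ∑ i, (v l.castSucc i : ℝ) := fun l => by
    rw [latticeCell, Real.sq_sqrt (hv.sum_nonneg (Fin.castSucc_lt_succ (i := l)).le),
      Finset.sum_sub_distrib]
  simp only [this]
  rw [Fin.sum_filter_succ_sub_castSucc (fun l => ∑ i, (v l i : ℝ)) h, Finset.sum_sub_distrib]

theorem IsLatticeChain.face {v : Fin (n + 1) → Fin k → ℤ} (hv : IsLatticeChain v)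
    (f : Fin (m + 1) ↪o Fin (n + 1)) :
    (latticeCell v).face f = latticeCell fun j => v (f j) := by
  ext1
  · funext t i
    exact stdSimplex.sum_map_mul f t (fun j => (v j i : ℝ))
  · funext j
    simp only [OrthoCell.face]
    rw [hv.normSq (f.monotone (Fin.castSucc_lt_succ (i := j)).le)]
    rfl

/-- At most one `e i` is nonzero, and it equals 1. This expresses the orthogonality of the edges of
a lattice chain, one coordinate at a time. -/
theorem sum_mul_sq_of_sum_le_one {ι : Type*} (s : Finset ι) (e : ι → ℤ) (x : ι → ℝ)
    (h0 : ∀ i ∈ s, 0 ≤ e i) (h1 : ∑ i ∈ s, e i ≤ 1) :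
    (∑ i ∈ s, (e i : ℝ) * x i) ^ 2 = ∑ i ∈ s, (e i : ℝ) * x i ^ 2 := by
  classical
  by_cases h : ∀ i ∈ s, e i = 0
  · rw [Finset.sum_eq_zero fun i hi => by simp [h i hi], Finset.sum_eq_zero fun i hi => by simp [h i hi]]
    simp
  · push Not at h
    obtain ⟨i, hi, hei⟩ := h
    have hpos : 1 ≤ e i := by have := h0 i hi; omega
    have hrest : ∑ l ∈ s.erase i, e l ≤ 0 := by
      have := Finset.add_sum_erase s e hi; linarith
    have hz : ∀ l ∈ s.erase i, e l = 0 := by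
      refine (Finset.sum_eq_zero_iff_of_nonneg fun l hl => h0 l (Finset.mem_of_mem_erase hl)).1 ?_
      exact le_antisymm hrest (Finset.sum_nonneg fun l hl => h0 l (Finset.mem_of_mem_erase hl))
    have h1' : e i = 1 := by
      have := Finset.add_sum_erase s e hi; rw [Finset.sum_eq_zero hz] at this; omega
    rw [← Finset.add_sum_erase s _ hi, ← Finset.add_sum_erase s _ hi,
      Finset.sum_eq_zero fun l hl => by simp [hz l hl],
      Finset.sum_eq_zero fun l hl => by simp [hz l hl], h1']
    simp

/-- A lattice simplex carries the Euclidean metric of `ℝᵏ`. -/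
theorem IsLatticeChain.dist_eq {v : Fin (m + 1) → Fin k → ℤ} (hv : IsLatticeChain v) (a b) :
    (latticeCell v).dist a b =
      dist (WithLp.toLp 2 ((latticeCell v).toFun a)) (WithLp.toLp 2 ((latticeCell v).toFun b)) := by
  rw [OrthoCell.dist, EuclideanSpace.dist_eq, EuclideanSpace.dist_eq]
  congr 1
  simp only [Real.dist_eq, sq_abs, orthoPoint_apply, latticeCell_apply_eq]
  have h1 : ∀ i : Fin m, ((latticeCell v).len i * tailSum a i - (latticeCell v).len i * tailSum b i) ^ 2
      = ∑ l, ((v i.succ l - v i.castSucc l : ℤ) : ℝ) * (tailSum a i - tailSum b i) ^ 2 := fun i => by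
    rw [← mul_sub, mul_pow, latticeCell,
      Real.sq_sqrt (hv.sum_nonneg (Fin.castSucc_lt_succ (i := i)).le), Finset.sum_mul]
    push_cast; rfl
  simp only [h1]
  rw [Finset.sum_comm]
  refine Finset.sum_congr rfl fun l _ => ?_
  -- The increments of the coordinate `l` along the chain are nonnegative and telescope to at most
  -- 1, so the cross terms vanish.
  rw [← sum_mul_sq_of_sum_le_one]
  · rw [add_sub_add_left_eq_sub, ← Finset.sum_sub_distrib]
    congr 1
    refine Finset.sum_congr rfl fun i _ => ?_
    push_cast; ring
  · exact fun i _ => sub_nonneg.2 (hv.mono (Fin.castSucc_lt_succ (i := i)).le l)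
  · have := Fin.sum_filter_succ_sub_castSucc (fun j => (v j l : ℝ)) (Fin.zero_le (Fin.last m))
    have h2 : ∑ i : Fin m, ((v i.succ l : ℝ) - v i.castSucc l) = v (Fin.last m) l - v 0 l := by
      rw [← this]; simp [Fin.castSucc_lt_last]
    have h3 : ∑ i : Fin m, (v i.succ l - v i.castSucc l) = v (Fin.last m) l - v 0 l := by
      exact_mod_cast h2
    rw [h3]; linarith [hv.last_le l]

theorem IsLatticeChain.injective {v : Fin (m + 1) → Fin k → ℤ} (hv : IsLatticeChain v) :
    Function.Injective (latticeCell v).toFun := by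
  intro a b h
  have h0 : orthoPoint (latticeCell v).len a = orthoPoint (latticeCell v).len b := by
    rw [← dist_eq_zero, ← OrthoCell.dist, hv.dist_eq, h, dist_self]
  refine stdSimplex.eq_of_tailSum_eq fun j => ?_
  have := congrArg (fun x => x j) h0
  simp only [orthoPoint_apply] at this
  exact mul_left_cancel₀ (hv.len_pos j).ne' this

/-! ### The simplices of the products -/

/-- The vertex (`d = 0`) or the edge (`d = 1`) of the line that starts in `a`. -/
noncomputable def lineCell (a : ℤ) (d : ℕ) : OrthoCell ℝ d :=
  ⟨fun t => ∑ j, t j * ((a + (j : ℕ) : ℤ) : ℝ), fun _ => 1⟩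

theorem mem_line_cells {d : ℕ} {σ : OrthoCell ℝ d} :
    σ ∈ line.cells d ↔ d ≤ 1 ∧ ∃ a, σ = lineCell a d := by
  match d with
  | 0 =>
    simp only [line, zero_le, true_and]
    refine exists_congr fun a => ?_
    have : lineCell a 0 = ⟨fun _ => (a : ℝ), fun _ => 1⟩ := by
      ext1
      · funext t; simp [lineCell]
      · rfl
    rw [this]
  | 1 =>
    simp only [line, le_refl, true_and]
    refine exists_congr fun a => ?_
    have : lineCell a 1 = ⟨fun t => (a : ℝ) + t 1, fun _ => 1⟩ := by
      ext1
      · funext t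
        have := stdSimplex.add_eq_one t
        have h0 : t 0 = 1 - t 1 := by linarith
        simp [lineCell, Fin.sum_univ_two, h0]; ring
      · rfl
    rw [this]
  | d + 2 => simp [line]

theorem lineCell_normSq (a : ℤ) {d : ℕ} {p q : Fin (d + 1)} (h : p ≤ q) :
    (lineCell a d).normSq p q = (q : ℕ) - (p : ℕ) := by
  rw [← Fin.sum_filter_succ_sub_castSucc (fun j : Fin (d + 1) => ((j : ℕ) : ℝ)) h]
  simp [OrthoCell.normSq, lineCell]

theorem prod_lineCell {d : Fin k → ℕ} (a : Fin k → ℤ) {c : Fin (m + 1) → ∀ i, Fin (d i + 1)}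
    (hc : StrictMono c) :
    OrthoCell.prod (fun i => lineCell (a i) (d i)) c =
      latticeCell (fun j i => a i + ((c j i : ℕ) : ℤ)) := by
  ext1
  · funext t i
    exact stdSimplex.sum_map_mul (fun j => c j i) t (fun j => ((a i + (j : ℕ) : ℤ) : ℝ))
  · funext j
    simp only [OrthoCell.prod, latticeCell]
    congr 1
    refine Finset.sum_congr rfl fun i _ => ?_
    rw [lineCell_normSq _ (hc.monotone (Fin.castSucc_lt_succ (i := j)).le i)]
    push_cast; ring

theorem isLatticeChain_of_strictMono {d : Fin k → ℕ} (hd : ∀ i, d i ≤ 1) (a : Fin k → ℤ)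
    {c : Fin (m + 1) → ∀ i, Fin (d i + 1)} (hc : StrictMono c) :
    IsLatticeChain (fun j i => a i + ((c j i : ℕ) : ℤ)) := by
  refine ⟨fun p q h => ?_, fun i => ?_⟩
  · obtain ⟨h1, i, hi⟩ := Pi.lt_def.1 (hc h)
    refine Pi.lt_def.2 ⟨fun i => ?_, i, ?_⟩
    · have := Fin.le_def.1 (h1 i); simpa using this
    · have := Fin.lt_def.1 hi; simpa using this
  · have := hd i
    have := (c (Fin.last m) i).2
    have := (c 0 i).2
    omega

theorem IsLatticeChain.exists_strictMono {v : Fin (m + 1) → Fin k → ℤ} (hv : IsLatticeChain v) :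
    ∃ c : Fin (m + 1) → ∀ _ : Fin k, Fin (1 + 1), StrictMono c ∧
      v = fun j i => v 0 i + ((c j i : ℕ) : ℤ) := by
  have hlt (j i) : (v j i - v 0 i).toNat < 1 + 1 := by
    have := hv.le_add_one 0 j i; omega
  have hval (j i) : v j i = v 0 i + ((v j i - v 0 i).toNat : ℤ) := by
    have := hv.zero_le j i; omega
  refine ⟨fun j i => ⟨(v j i - v 0 i).toNat, hlt j i⟩, fun p q h => ?_, funext₂ hval⟩
  obtain ⟨h1, i, hi⟩ := Pi.lt_def.1 (hv.strictMono h)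
  refine Pi.lt_def.2 ⟨fun i => ?_, i, ?_⟩
  · have : v p i ≤ v q i := h1 i
    simp only [Fin.le_def]; omega
  · have := hv.zero_le p i; simp only [Fin.lt_def]; omega

/-- In the converse all factors are taken to be edges, even where the chain is constant: a unit cube
contains every chain. -/
theorem mem_line_prod_cells {ρ : OrthoCell (Fin k → ℝ) m} :
    ρ ∈ (line.prod k).cells m ↔ ∃ v, IsLatticeChain v ∧ ρ = latticeCell v := by
  constructor
  · rintro ⟨d, σ, c, hσ, hc, rfl⟩
    choose hd a ha using fun i => mem_line_cells.1 (hσ i)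
    obtain rfl : σ = fun i => lineCell (a i) (d i) := funext ha
    exact ⟨_, isLatticeChain_of_strictMono hd a hc, prod_lineCell a hc⟩
  · rintro ⟨v, hv, rfl⟩
    obtain ⟨c, hc, hvc⟩ := hv.exists_strictMono
    refine ⟨fun _ => 1, fun i => lineCell (v 0 i) 1, c, fun i => mem_line_cells.2 ⟨le_rfl, _, rfl⟩,
      hc, ?_⟩
    rw [prod_lineCell _ hc, ← hvc]

/-- The covering `ℝᵏ → (ℝ/nℤ)ᵏ`. -/
def wrap (n : ℕ) (x : Fin k → ℝ) : Fin k → AddCircle (n : ℝ) := fun i => (x i : AddCircle (n : ℝ))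

theorem mem_cycle_prod_cells {ρ : OrthoCell (Fin k → AddCircle (n : ℝ)) m} :
    ρ ∈ ((cycle n).prod k).cells m ↔
      ∃ v, IsLatticeChain v ∧ ρ = (latticeCell v).map (wrap n) := by
  constructor
  · rintro ⟨d, σ, c, hσ, hc, rfl⟩
    choose σ' hσ' hσσ' using hσ
    choose hd a ha using fun i => mem_line_cells.1 (hσ' i)
    obtain rfl : σ' = fun i => lineCell (a i) (d i) := funext ha
    obtain rfl := funext hσσ'
    exact ⟨_, isLatticeChain_of_strictMono hd a hc, by rw [← prod_lineCell a hc]; rfl⟩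
  · rintro ⟨v, hv, rfl⟩
    obtain ⟨c, hc, hvc⟩ := hv.exists_strictMono
    refine ⟨fun _ => 1, fun i => (lineCell (v 0 i) 1).map (fun x : ℝ => (x : AddCircle (n : ℝ))), c,
      fun i => ⟨_, mem_line_cells.2 ⟨le_rfl, _, rfl⟩, rfl⟩, hc, ?_⟩
    have h := congrArg (OrthoCell.map (wrap n)) (prod_lineCell (v 0) hc)
    rw [← hvc] at h
    rw [← h]
    rfl

theorem wrap_eq_wrap_iff {x y : Fin k → ℝ} :
    wrap n x = wrap n y ↔ ∃ N : Fin k → ℤ, ∀ i, x i = y i + n * N i := by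
  rw [← Classical.skolem (p := fun i (N : ℤ) => x i = y i + n * N), funext_iff]
  refine forall_congr' fun i => ?_
  rw [wrap, wrap, ← sub_eq_zero, ← AddCircle.coe_sub, AddCircle.coe_eq_zero_iff]
  refine exists_congr fun N => ?_
  rw [zsmul_eq_mul, mul_comm, eq_comm, sub_eq_iff_eq_add, add_comm]

end Lattice

/-! ### The simplex carrying a point of `ℝᵏ` -/

section Carrier

variable {k m m' n : ℕ}

/-- The sum of the barycentric coordinates before the `j`-th one. -/
def headSum (t : stdSimplex ℝ (Fin (m + 1))) (j : Fin (m + 1)) : ℝ :=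
  ∑ l : Fin (m + 1) with l < j, t l

theorem headSum_zero (t : stdSimplex ℝ (Fin (m + 1))) : headSum t 0 = 0 := by
  simp [headSum]

theorem headSum_nonneg (t : stdSimplex ℝ (Fin (m + 1))) (j) : 0 ≤ headSum t j :=
  Finset.sum_nonneg fun l _ => stdSimplex.zero_le t l

theorem headSum_strictMono {t : stdSimplex ℝ (Fin (m + 1))} (ht : ∀ j, 0 < t j) :
    StrictMono (headSum t) := by
  intro a b hab
  refine Finset.sum_lt_sum_of_subset (i := a) (fun l hl => ?_) (by simpa using hab) (by simp)
    (ht a) fun l _ _ => stdSimplex.zero_le t l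
  simp only [Finset.mem_filter, Finset.mem_univ, true_and] at hl ⊢
  exact hl.trans hab

theorem headSum_lt_one {t : stdSimplex ℝ (Fin (m + 1))} (ht : ∀ j, 0 < t j) (j) :
    headSum t j < 1 := by
  rw [← stdSimplex.sum_eq_one t]
  exact Finset.sum_lt_sum_of_subset (i := j) (Finset.filter_subset _ _) (Finset.mem_univ _)
    (by simp) (ht j) fun l _ _ => stdSimplex.zero_le t l

theorem latticeCell_add_headSum (v : Fin (m + 1) → Fin k → ℤ) (t) (i) (j) :
    (latticeCell v).toFun t i + headSum t j =
      ∑ l, t l * ((v l i : ℝ) + if l < j then 1 else 0) := by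
  simp only [latticeCell_apply, headSum, mul_add, Finset.sum_add_distrib, Finset.sum_filter]
  congr 1
  exact Finset.sum_congr rfl fun l _ => by split_ifs <;> simp

/-- Adding `headSum t j` raises the vertices before `j` by 1. The result is a convex combination of
integers in `[v j i, v j i + 1]`, in which `v j i` itself has the positive weight `t j`. Thus the
vertices can be read off from the point and the head sums. -/
theorem IsLatticeChain.floor_add_headSum {v : Fin (m + 1) → Fin k → ℤ} (hv : IsLatticeChain v)
    {t : stdSimplex ℝ (Fin (m + 1))} (ht : ∀ j, 0 < t j) (j i) :
    ⌊(latticeCell v).toFun t i + headSum t j⌋ = v j i := by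
  rw [latticeCell_add_headSum, Int.floor_eq_iff]
  have h1 : (v j i : ℝ) = ∑ l, t l * (v j i : ℝ) := by rw [← Finset.sum_mul, stdSimplex.sum_eq_one t, one_mul]
  have h2 : (v j i : ℝ) + 1 = ∑ l, t l * ((v j i : ℝ) + 1) := by
    rw [← Finset.sum_mul, stdSimplex.sum_eq_one t, one_mul]
  constructor
  · rw [h1]
    refine Finset.sum_le_sum fun l _ => mul_le_mul_of_nonneg_left ?_ (stdSimplex.zero_le t l)
    split_ifs with h
    · exact_mod_cast hv.le_add_one l j i
    · exact_mod_cast (hv.mono (not_lt.1 h) i).trans (by simp)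
  · rw [h2]
    refine Finset.sum_lt_sum (fun l _ => mul_le_mul_of_nonneg_left ?_ (stdSimplex.zero_le t l))
      ⟨j, Finset.mem_univ _, mul_lt_mul_of_pos_left (by simp) (ht j)⟩
    split_ifs with h
    · exact_mod_cast Int.add_le_add_right (hv.mono h.le i) 1
    · exact_mod_cast (by simpa using hv.le_add_one j l i : v l i + 0 ≤ v j i + 1)

theorem latticeCell_add_headSum_of_jump {v : Fin (m + 1) → Fin k → ℤ}
    (t : stdSimplex ℝ (Fin (m + 1))) {i : Fin k} {j : Fin (m + 1)} {c : ℤ}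
    (h1 : ∀ l < j, v l i + 1 = c) (h2 : ∀ l, j ≤ l → v l i = c) :
    (latticeCell v).toFun t i + headSum t j = c := by
  rw [latticeCell_add_headSum]
  calc _ = ∑ l, t l * (c : ℝ) := Finset.sum_congr rfl fun l _ => by
        split_ifs with h
        · rw [← h1 l h]; push_cast; rfl
        · rw [h2 l (not_lt.1 h), add_zero]
    _ = c := by rw [← Finset.sum_mul, stdSimplex.sum_eq_one t, one_mul]

/-- The translations in `[0, 1)` along the diagonal that move a coordinate of `x` to an integer,
together with `0`. -/
def breakpoints (x : Fin k → ℝ) : Set ℝ :=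
  {s | 0 ≤ s ∧ s < 1 ∧ (s = 0 ∨ ∃ i, ∃ c : ℤ, x i + s = c)}

/-- Some coordinate jumps between consecutive vertices, and the translation by the head sum at the
jump makes it an integer. So the set of head sums depends only on the point. -/
theorem IsLatticeChain.range_headSum {v : Fin (m + 1) → Fin k → ℤ} (hv : IsLatticeChain v)
    {t : stdSimplex ℝ (Fin (m + 1))} (ht : ∀ j, 0 < t j) :
    Set.range (headSum t) = breakpoints ((latticeCell v).toFun t) := by
  ext s
  constructor
  · rintro ⟨j, rfl⟩
    refine ⟨headSum_nonneg t j, headSum_lt_one ht j, ?_⟩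
    rcases Fin.eq_zero_or_eq_succ j with rfl | ⟨j, rfl⟩
    · exact Or.inl (headSum_zero t)
    · obtain ⟨-, i, hi⟩ := Pi.lt_def.1 (hv.strictMono (Fin.castSucc_lt_succ (i := j)))
      refine Or.inr ⟨i, v j.succ i, latticeCell_add_headSum_of_jump t (fun l hl => ?_) fun l hl => ?_⟩
      · have h1 := hv.mono (Fin.le_castSucc_iff.2 hl) i
        have h2 := hv.le_add_one l j.succ i
        omega
      · have h1 := hv.mono hl i
        have h2 := hv.le_add_one j.castSucc l i
        omega
  · rintro ⟨h0, h1, rfl | ⟨i, c, hc⟩⟩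
    · exact ⟨0, headSum_zero t⟩
    · rcases h0.eq_or_lt with rfl | hpos
      · exact ⟨0, headSum_zero t⟩
      -- If the coordinate `i` jumps, the head sum at its first raised vertex also makes it an
      -- integer, and two numbers in `[0, 1)` with integral difference agree. If it never jumps, `s`
      -- would be an integer strictly between 0 and 1.
      by_cases hA : ∃ j, v j i = v 0 i + 1
      · classical
        obtain ⟨j, hj, hmin⟩ := WellFounded.has_min (wellFounded_lt (α := Fin (m + 1)))
          {j | v j i = v 0 i + 1} hA
        have hjump := latticeCell_add_headSum_of_jump (v := v) t (i := i) (j := j) (c := v 0 i + 1)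
          (fun l hl => by
            have h3 := hv.zero_le l i
            have h4 := hv.le_add_one 0 l i
            have h5 : v l i ≠ v 0 i + 1 := fun h => hmin l h hl
            omega)
          (fun l hl => by
            have h3 := hv.mono hl i
            have h4 := hv.le_add_one 0 l i
            have h5 : v j i = v 0 i + 1 := hj
            omega)
        refine ⟨j, ?_⟩
        have h6 := headSum_nonneg t j
        have h7 := headSum_lt_one ht j
        have h8 : s - headSum t j = ((c - (v 0 i + 1) : ℤ) : ℝ) := by push_cast at hjump ⊢; linarith
        have h9 : (c - (v 0 i + 1) : ℤ) < 1 := by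
          rw [← Int.cast_lt (R := ℝ), ← h8]; push_cast; linarith
        have h10 : -1 < (c - (v 0 i + 1) : ℤ) := by
          rw [← Int.cast_lt (R := ℝ), ← h8]; push_cast; linarith
        have h11 : c - (v 0 i + 1) = 0 := by omega
        rw [h11] at h8
        push_cast at h8
        linarith
      · exfalso
        have hall : ∀ j, v j i = v 0 i := fun j => by
          have h3 := hv.zero_le j i
          have h4 := hv.le_add_one 0 j i
          have h5 : v j i ≠ v 0 i + 1 := fun h => hA ⟨j, h⟩
          omega
        have hx : (latticeCell v).toFun t i = v 0 i := by
          simp only [latticeCell_apply, hall]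
          rw [← Finset.sum_mul, stdSimplex.sum_eq_one t, one_mul]
        have h8 : s = ((c - v 0 i : ℤ) : ℝ) := by push_cast; linarith
        rw [h8] at hpos h1
        have h3 : (0 : ℤ) < c - v 0 i := by exact_mod_cast hpos
        have h4 : (c - v 0 i : ℤ) < 1 := by exact_mod_cast h1
        omega

/-- A point of `ℝᵏ` lies in the interior of at most one lattice simplex. -/
theorem IsLatticeChain.eq_of_interior {v : Fin (m + 1) → Fin k → ℤ} (hv : IsLatticeChain v)
    {v' : Fin (m' + 1) → Fin k → ℤ} (hv' : IsLatticeChain v')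
    {t : stdSimplex ℝ (Fin (m + 1))} {t' : stdSimplex ℝ (Fin (m' + 1))}
    (ht : ∀ j, 0 < t j) (ht' : ∀ j, 0 < t' j)
    (h : (latticeCell v).toFun t = (latticeCell v').toFun t') :
    (⟨m, v⟩ : Σ m, Fin (m + 1) → Fin k → ℤ) = ⟨m', v'⟩ := by
  have hr : Set.range (headSum t) = Set.range (headSum t') := by
    rw [hv.range_headSum ht, hv'.range_headSum ht', h]
  have hm : m + 1 = m' + 1 := by
    have h1 := Set.card_range_of_injective (headSum_strictMono ht).injective
    have h2 := Set.card_range_of_injective (headSum_strictMono ht').injective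
    simp only [Fintype.card_fin] at h1 h2
    rw [← h1, ← h2]
    exact Fintype.card_congr (Equiv.setCongr hr)
  obtain rfl : m = m' := by omega
  -- Increasing enumerations of the same set coincide, so both vertex lists are floors of the same
  -- translates.
  have hu := ((headSum_strictMono ht).range_inj (headSum_strictMono ht')).1 hr
  congr 1
  funext j i
  rw [← hv.floor_add_headSum ht, ← hv'.floor_add_headSum ht', h, hu]

/-- `Int.fract (-x i)` is the first `s ≥ 0` at which `x i + s` is an integer. These values and 0 are
the future head sums, listed in increasing order. -/
theorem exists_thresholds (x : Fin k → ℝ) : ∃ (m : ℕ) (u : Fin (m + 1) → ℝ), StrictMono u ∧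
    u 0 = 0 ∧ (∀ j, u j < 1) ∧ (∀ j, u j = 0 ∨ ∃ i, u j = Int.fract (-x i)) ∧
      ∀ i, ∃ j, u j = Int.fract (-x i) := by
  classical
  set S : Finset ℝ := insert 0 (Finset.univ.image fun i => Int.fract (-x i)) with hS
  have h0 : (0 : ℝ) ∈ S := Finset.mem_insert_self _ _
  have hmem {s : ℝ} : s ∈ S ↔ s = 0 ∨ ∃ i, s = Int.fract (-x i) := by
    simp [hS, eq_comm]
  have hcard : S.card = (S.card - 1) + 1 := by
    have := Finset.card_pos.2 ⟨0, h0⟩; omega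
  refine ⟨S.card - 1, S.orderEmbOfFin hcard, (S.orderEmbOfFin hcard).strictMono, ?_, fun j => ?_,
    fun j => hmem.1 (S.orderEmbOfFin_mem hcard j), fun i => ?_⟩
  · have hr := Finset.range_orderEmbOfFin S hcard
    have : (0 : ℝ) ∈ Set.range (S.orderEmbOfFin hcard) := by rw [hr]; exact h0
    obtain ⟨j, hj⟩ := this
    refine le_antisymm ?_ ?_
    · rw [← hj]; exact (S.orderEmbOfFin hcard).monotone (Fin.zero_le j)
    · rcases hmem.1 (S.orderEmbOfFin_mem hcard 0) with h | ⟨i, h⟩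
      · rw [h]
      · rw [h]; exact Int.fract_nonneg _
  · rcases hmem.1 (S.orderEmbOfFin_mem hcard j) with h | ⟨i, h⟩
    · rw [h]; exact one_pos
    · rw [h]; exact Int.fract_lt_one _
  · have hr := Finset.range_orderEmbOfFin S hcard
    have : Int.fract (-x i) ∈ Set.range (S.orderEmbOfFin hcard) := by
      rw [hr]; exact hmem.2 (Or.inr ⟨i, rfl⟩)
    exact this

/-- Every point of `ℝᵏ` lies in a lattice simplex, whose vertices satisfy all the integral lower
bounds on differences of coordinates that hold at the point. -/
theorem exists_latticeCell_apply_eq (x : Fin k → ℝ) :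
    ∃ (m : ℕ) (v : Fin (m + 1) → Fin k → ℤ) (t : stdSimplex ℝ (Fin (m + 1))), IsLatticeChain v ∧
      (latticeCell v).toFun t = x ∧
      (∀ j i, |(v j i : ℝ) - x i| ≤ 1) ∧
      ∀ i j (c : ℤ), (c : ℝ) ≤ x i - x j → ∀ l, c ≤ v l i - v l j := by
  obtain ⟨m, u, hu, hu0, hu1, hmem, hex⟩ := exists_thresholds x
  have hunn : ∀ j, 0 ≤ u j := fun j => hu0 ▸ hu.monotone (Fin.zero_le j)
  -- During the diagonal translation the floor of the coordinate `i` changes from `⌈x i⌉ - 1` to `⌈x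
  -- i⌉` at its threshold; here `-⌊-x i⌋ = ⌈x i⌉`.
  have hfl (i j j0) (h : u j0 = Int.fract (-x i)) :
      ⌊x i + u j⌋ = -⌊-x i⌋ - 1 + if j0 ≤ j then 1 else 0 := by
    have h1 := Int.floor_add_fract (-x i)
    have h3 := hu1 j
    have h4 := hunn j
    have h5 := hu1 j0
    have h6 := Int.fract_nonneg (-x i)
    rw [Int.floor_eq_iff]
    split_ifs with hj
    · have h2 := hu.monotone hj
      push_cast; constructor <;> linarith
    · have h2 := hu (not_le.1 hj)
      push_cast; constructor <;> linarith
  -- With 1 appended as a last threshold, the barycentric coordinates are the gaps between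
  -- consecutive thresholds.
  set U : Fin (m + 2) → ℝ := Fin.snoc (α := fun _ => ℝ) u 1 with hU
  have hUc (j : Fin (m + 1)) : U j.castSucc = u j := Fin.snoc_castSucc (α := fun _ => ℝ) _ _ _
  have hUl : U (Fin.last (m + 1)) = 1 := Fin.snoc_last (α := fun _ => ℝ) _ _
  have hsum (a : Fin (m + 1)) : ∑ l : Fin (m + 1) with a ≤ l, (U l.succ - U l.castSucc) = 1 - u a := by
    have := Fin.sum_filter_succ_sub_castSucc U (Fin.le_last a.castSucc)
    rw [hUl, hUc] at this
    rw [← this]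
    refine Finset.sum_congr ?_ fun _ _ => rfl
    ext l
    simp [Fin.castSucc_lt_last]
  let t : stdSimplex ℝ (Fin (m + 1)) := ⟨fun l => U l.succ - U l.castSucc, fun l => ?_, ?_⟩
  · have htl (l) : t l = U l.succ - U l.castSucc := rfl
    -- These vertices are the ones suggested by `IsLatticeChain.floor_add_headSum`.
    refine ⟨m, fun j i => ⌊x i + u j⌋, t, ⟨fun p q hpq => ?_, fun i => ?_⟩, ?_, fun j i => ?_,
      fun i j c hc l => ?_⟩
    · refine Pi.lt_def.2 ⟨fun i => Int.floor_mono (by linarith [hu hpq]), ?_⟩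
      rcases hmem q with h | ⟨i, h⟩
      · exact absurd (h ▸ hu hpq) (not_lt.2 (hunn p))
      · refine ⟨i, ?_⟩
        rw [hfl i p q h, hfl i q q h, if_neg (not_le.2 hpq), if_pos le_rfl]
        omega
    · rw [← Int.floor_add_one]
      exact Int.floor_mono (by linarith [hu1 (Fin.last m), hunn 0])
    · funext i
      obtain ⟨j0, h⟩ := hex i
      rw [latticeCell_apply]
      have h1 := Int.floor_add_fract (-x i)
      have h2 : ∀ l, t l * ((⌊x i + u l⌋ : ℤ) : ℝ) = t l * ((-⌊-x i⌋ - 1 : ℤ) : ℝ) +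
          if j0 ≤ l then t l else 0 := fun l => by
        rw [hfl i l j0 h]
        split_ifs <;> push_cast <;> ring
      simp only [h2]
      rw [Finset.sum_add_distrib, ← Finset.sum_mul, stdSimplex.sum_eq_one t, ← Finset.sum_filter]
      simp only [htl]
      rw [hsum]
      push_cast
      linarith
    · have h1 := Int.floor_le (x i + u j)
      have h2 := Int.lt_floor_add_one (x i + u j)
      have h3 := hu1 j
      have h4 := hunn j
      rw [abs_le]
      constructor <;> linarith
    · have : (⌊x j + u l⌋ + c : ℤ) ≤ ⌊x i + u l⌋ := by
        rw [← Int.floor_add_intCast]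
        exact Int.floor_mono (by linarith)
      change c ≤ ⌊x i + u l⌋ - ⌊x j + u l⌋
      omega
  · rcases Fin.eq_castSucc_or_eq_last l with ⟨l, rfl⟩ | rfl
    · change 0 ≤ U l.castSucc.succ - U l.castSucc.castSucc
      rw [← Fin.castSucc_succ, hUc, hUc]
      exact sub_nonneg.2 (hu.monotone (Fin.castSucc_lt_succ (i := l)).le)
    · change 0 ≤ U (Fin.last m).succ - U (Fin.last m).castSucc
      rw [Fin.succ_last, hUl, hUc]
      exact sub_nonneg.2 (hu1 _).le
  · have := hsum 0
    simpa [hu0] using this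

end Carrier

/-! ### The products are orthoscheme complexes -/

section Complexes

variable {k m m' n : ℕ}

theorem line_prod_isOrthoschemeComplex (k : ℕ) : (line.prod k).IsOrthoschemeComplex where
  len_pos m σ hσ i := by
    obtain ⟨v, hv, rfl⟩ := mem_line_prod_cells.1 hσ
    exact hv.len_pos i
  covers x := by
    obtain ⟨m, v, t, hv, ht, -⟩ := exists_latticeCell_apply_eq x
    exact ⟨m, _, mem_line_prod_cells.2 ⟨v, hv, rfl⟩, t, ht⟩
  injOn_interior m σ hσ := by
    obtain ⟨v, hv, rfl⟩ := mem_line_prod_cells.1 hσ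
    exact hv.injective.injOn
  face_mem m n σ hσ f := by
    obtain ⟨v, hv, rfl⟩ := mem_line_prod_cells.1 hσ
    exact mem_line_prod_cells.2 ⟨_, hv.comp f, hv.face f⟩
  eq_of_interior m m' σ hσ σ' hσ' t t' ht ht' h := by
    obtain ⟨v, hv, rfl⟩ := mem_line_prod_cells.1 hσ
    obtain ⟨v', hv', rfl⟩ := mem_line_prod_cells.1 hσ'
    cases hv.eq_of_interior hv' ht ht' h
    rfl

theorem wrap_add_mul (x : Fin k → ℝ) (N : Fin k → ℤ) :
    wrap n (fun i => x i + n * N i) = wrap n x :=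
  wrap_eq_wrap_iff.2 ⟨N, fun _ => rfl⟩

theorem wrap_surjective (n : ℕ) : Function.Surjective (wrap n : (Fin k → ℝ) → _) := by
  intro x
  choose y hy using fun i => QuotientAddGroup.mk_surjective (x i)
  exact ⟨y, funext hy⟩

/-- The identity permutation stays visible so that the statement matches `IsLatticeChain.transform`.
-/
theorem latticeCell_map_wrap_transform (v : Fin (m + 1) → Fin k → ℤ) (N : Fin k → ℤ) :
    (latticeCell fun j i => v j (Equiv.refl _ i) + n * N i).map (wrap n) =
      (latticeCell v).map (wrap n) := by
  ext1
  · funext t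
    refine Eq.trans ?_ (wrap_add_mul _ N)
    refine congrArg (wrap n) (funext fun i => ?_)
    have := latticeCell_transform_apply v (Equiv.refl _) (fun i => n * N i) t i
    push_cast at this
    exact this
  · exact latticeCell_transform_len v (Equiv.refl _) fun i => n * N i

/-- The simplices of `(ℝ/nℤ)ᵏ` lift to `ℝᵏ`, through every lift of one of their points. -/
theorem exists_latticeCell_through {σ : OrthoCell (Fin k → AddCircle (n : ℝ)) m}
    (hσ : σ ∈ ((cycle n).prod k).cells m) {t : stdSimplex ℝ (Fin (m + 1))} {y : Fin k → ℝ}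
    (h : wrap n y = σ.toFun t) :
    ∃ v, IsLatticeChain v ∧ (latticeCell v).toFun t = y ∧ σ = (latticeCell v).map (wrap n) := by
  obtain ⟨v, hv, rfl⟩ := mem_cycle_prod_cells.1 hσ
  obtain ⟨N, hN⟩ := wrap_eq_wrap_iff.1 h
  refine ⟨_, hv.transform (Equiv.refl _) fun i => n * N i, ?_,
    (latticeCell_map_wrap_transform v N).symm⟩
  funext i
  rw [latticeCell_transform_apply, hN]
  push_cast
  rfl

theorem cycle_prod_isOrthoschemeComplex (k n : ℕ) :
    ((cycle n).prod k).IsOrthoschemeComplex where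
  len_pos m σ hσ i := by
    obtain ⟨v, hv, rfl⟩ := mem_cycle_prod_cells.1 hσ
    exact hv.len_pos i
  covers x := by
    obtain ⟨y, rfl⟩ := wrap_surjective n x
    obtain ⟨m, v, t, hv, ht, -⟩ := exists_latticeCell_apply_eq y
    exact ⟨m, _, mem_cycle_prod_cells.2 ⟨v, hv, rfl⟩, t, congrArg (wrap n) ht⟩
  injOn_interior m σ hσ t ht t' ht' h := by
    obtain ⟨v, hv, rfl⟩ := mem_cycle_prod_cells.1 hσ
    obtain ⟨N, hN⟩ := wrap_eq_wrap_iff.1 h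
    have hN' : (latticeCell v).toFun t =
        (latticeCell fun j i => v j (Equiv.refl _ i) + n * N i).toFun t' := by
      funext i
      rw [latticeCell_transform_apply, hN]
      push_cast
      rfl
    -- The simplex and its translate share an interior point, hence coincide, and injectivity
    -- upstairs applies.
    have hvv := eq_of_heq (Sigma.mk.inj (hv.eq_of_interior (hv.transform _ _) ht ht' hN')).2
    rw [← hvv] at hN'
    exact hv.injective hN'
  face_mem m n σ hσ f := by
    obtain ⟨v, hv, rfl⟩ := mem_cycle_prod_cells.1 hσ
    refine mem_cycle_prod_cells.2 ⟨_, hv.comp f, ?_⟩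
    rw [← hv.face f]
    rfl
  eq_of_interior m m' σ hσ σ' hσ' t t' ht ht' h := by
    obtain ⟨v, hv, rfl⟩ := mem_cycle_prod_cells.1 hσ
    obtain ⟨v', hv', hvt, rfl⟩ := exists_latticeCell_through hσ' h
    cases hv.eq_of_interior hv' ht ht' hvt.symm
    rfl

/-! ### Subcomplexes and quotients of orthoscheme complexes -/

variable {K : Type u} {L : Type v}

theorem OrthoCell.map_injective {f : K → L} (hf : Function.Injective f) :
    Function.Injective (OrthoCell.map f : OrthoCell K m → OrthoCell L m) := by
  intro σ τ h
  ext1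
  · funext t
    exact hf (congrFun (congrArg OrthoCell.toFun h) t)
  · exact (OrthoCell.mk.inj h).2

namespace OrthoSystem

theorem IsOrthoschemeComplex.sub {S : OrthoSystem K} (hS : S.IsOrthoschemeComplex)
    {P : ∀ m, OrthoCell K m → Prop}
    (hP : ∀ m n (σ : OrthoCell K n) (f : Fin (m + 1) ↪o Fin (n + 1)), P n σ → P m (σ.face f)) :
    (S.sub P).IsOrthoschemeComplex where
  len_pos m σ hσ := hS.len_pos m _ hσ.1
  covers := by
    rintro ⟨x, m, σ, hσ, hPσ, t, rfl⟩
    exact ⟨m, ⟨fun t => ⟨σ.toFun t, m, σ, hσ, hPσ, t, rfl⟩, σ.len⟩, ⟨hσ, hPσ⟩, t, rfl⟩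
  injOn_interior m σ hσ t ht t' ht' h := hS.injOn_interior m _ hσ.1 ht ht' (congrArg Subtype.val h)
  face_mem m n σ hσ f := ⟨hS.face_mem m n _ hσ.1 f, hP m n _ f hσ.2⟩
  eq_of_interior m m' σ hσ σ' hσ' t t' ht ht' h := by
    have h1 := hS.eq_of_interior m m' _ hσ.1 _ hσ'.1 t t' ht ht' (congrArg Subtype.val h)
    obtain rfl := congrArg Sigma.fst h1
    rw [OrthoCell.map_injective Subtype.val_injective (eq_of_heq (Sigma.mk.inj h1).2)]

/-- The quotient of an orthoscheme complex by an equivalence relation generated by automorphisms. -/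
theorem IsOrthoschemeComplex.map_quotient {S : OrthoSystem K} (hS : S.IsOrthoschemeComplex)
    (s : Setoid K)
    (hs : ∀ x y, s x y → ∃ f : K → K, f y = x ∧ (∀ z, s z (f z)) ∧
      ∀ m, ∀ σ ∈ S.cells m, σ.map f ∈ S.cells m) :
    (S.map (Quotient.mk s)).IsOrthoschemeComplex where
  len_pos := by
    rintro m _ ⟨σ, hσ, rfl⟩ i
    exact hS.len_pos m σ hσ i
  covers := by
    rintro ⟨x⟩
    obtain ⟨m, σ, hσ, t, rfl⟩ := hS.covers x
    exact ⟨m, _, ⟨σ, hσ, rfl⟩, t, rfl⟩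
  injOn_interior := by
    rintro m _ ⟨σ, hσ, rfl⟩ t ht t' ht' h
    obtain ⟨f, hf, -, hfS⟩ := hs _ _ (Quotient.exact h)
    -- The automorphism matching the two points carries `σ` to a simplex that meets the interior of
    -- `σ`, so it fixes `σ` pointwise.
    have h1 := hS.eq_of_interior m m σ hσ _ (hfS m σ hσ) t t' ht ht' hf.symm
    have h2 := eq_of_heq (Sigma.mk.inj h1).2
    refine hS.injOn_interior m σ hσ ht ht' ?_
    rw [← hf]
    exact (congrFun (congrArg OrthoCell.toFun h2) t').symm
  face_mem := by
    rintro m n _ ⟨σ, hσ, rfl⟩ f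
    exact ⟨σ.face f, hS.face_mem m n σ hσ f, rfl⟩
  eq_of_interior := by
    rintro m m' _ ⟨σ, hσ, rfl⟩ _ ⟨σ', hσ', rfl⟩ t t' ht ht' h
    obtain ⟨f, hf, hfs, hfS⟩ := hs _ _ (Quotient.exact h)
    have h1 := hS.eq_of_interior m m' σ hσ _ (hfS m' σ' hσ') t t' ht ht' hf.symm
    obtain rfl := congrArg Sigma.fst h1
    rw [eq_of_heq (Sigma.mk.inj h1).2]
    congr 1
    ext1
    · funext t
      exact (Quotient.sound (hfs (σ'.toFun t))).symm
    · rfl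

end OrthoSystem

theorem OrthoCell.vertex_face (σ : OrthoCell K n) (f : Fin (m + 1) ↪o Fin (n + 1)) (j) :
    (σ.face f).vertex j = σ.vertex (f j) := by
  simp only [OrthoCell.vertex, OrthoCell.face]
  rw [stdSimplex.map_vertex]

theorem OrthoCell.range_face_subset (σ : OrthoCell K n) (f : Fin (m + 1) ↪o Fin (n + 1)) :
    Set.range (σ.face f).toFun ⊆ Set.range σ.toFun := by
  rintro _ ⟨t, rfl⟩
  exact ⟨_, rfl⟩

theorem column_isOrthoschemeComplex (k n : ℕ) : (column k n).IsOrthoschemeComplex :=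
  (line_prod_isOrthoschemeComplex k).sub fun m n σ f h j => by
    simp only [OrthoCell.vertex_face]
    exact h (f j)

theorem conf_isOrthoschemeComplex (k n : ℕ) :
    (conf k (cycle n)).IsOrthoschemeComplex :=
  (cycle_prod_isOrthoschemeComplex k n).sub fun _ _ σ f h =>
    h.mono_left (σ.range_face_subset f)

/-! ### Permuting the labels -/

theorem OrthoSystem.prod_perm {S : OrthoSystem K} (π : Equiv.Perm (Fin k))
    {σ : OrthoCell (Fin k → K) m} (hσ : σ ∈ (S.prod k).cells m) :
    σ.map (fun x => x ∘ π) ∈ (S.prod k).cells m := by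
  obtain ⟨d, τ, c, hτ, hc, rfl⟩ := hσ
  refine ⟨fun i => d (π i), fun i => τ (π i), fun j i => c j (π i), fun i => hτ (π i), ?_, ?_⟩
  · intro a b hab
    obtain ⟨h1, i, hi⟩ := Pi.lt_def.1 (hc hab)
    refine Pi.lt_def.2 ⟨fun i => h1 (π i), π.symm i, ?_⟩
    have : ∀ i', i' = i → c a i' < c b i' := by rintro _ rfl; exact hi
    exact this _ (π.apply_symm_apply i)
  · ext1
    · rfl
    · funext j
      simp only [OrthoCell.map, OrthoCell.prod]
      congr 1
      exact (Equiv.sum_comp π (fun i => (τ i).normSq (c j.castSucc i) (c j.succ i))).symm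

theorem avoidsDiag_perm (π : Equiv.Perm (Fin k)) {σ : OrthoCell (Fin k → K) m}
    (hσ : AvoidsDiag k m σ) : AvoidsDiag k m (σ.map fun x => x ∘ π) := by
  refine Set.disjoint_left.2 ?_
  rintro _ ⟨t, rfl⟩ ⟨i, j, hij, h⟩
  exact Set.disjoint_left.1 hσ ⟨t, rfl⟩ ⟨π i, π j, fun h => hij (π.injective h), h⟩

/-- Permuting the labels of a configuration. -/
def confPerm {S : OrthoSystem K} (π : Equiv.Perm (Fin k)) (x : ConfSpace k S) : ConfSpace k S :=
  ⟨x.1 ∘ π, by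
    obtain ⟨m, σ, hσ, hP, t, ht⟩ := x.2
    exact ⟨m, _, OrthoSystem.prod_perm π hσ, avoidsDiag_perm π hP, t, by rw [← ht]; rfl⟩⟩

theorem conf_perm {S : OrthoSystem K} (π : Equiv.Perm (Fin k)) {σ : OrthoCell (ConfSpace k S) m}
    (hσ : σ ∈ (conf k S).cells m) : σ.map (confPerm π) ∈ (conf k S).cells m :=
  ⟨OrthoSystem.prod_perm π hσ.1, avoidsDiag_perm π hσ.2⟩

theorem uconf_isOrthoschemeComplex (k n : ℕ) :
    (uconf k (cycle n)).IsOrthoschemeComplex := by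
  refine (conf_isOrthoschemeComplex k n).map_quotient _ fun x y hxy => ?_
  obtain ⟨π, hπ⟩ := (confSetoid k (cycle n)).symm hxy
  exact ⟨confPerm π, Subtype.ext hπ.symm, fun z => ⟨π, rfl⟩, fun m σ => conf_perm π⟩

end Complexes

/-! ### Polyhedra given by integral bounds on differences of coordinates -/

section Polyhedra

variable {k m n : ℕ}

/-- The polyhedron of all `z` with `c ≤ z i - z j` for all `(i, j, c) ∈ R`. -/
def diffPolyhedron (R : Set (Fin k × Fin k × ℤ)) : Set (Fin k → ℝ) :=
  {z | ∀ r ∈ R, (r.2.2 : ℝ) ≤ z r.1 - z r.2.1}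

theorem convex_diffPolyhedron (R : Set (Fin k × Fin k × ℤ)) : Convex ℝ (diffPolyhedron R) := by
  intro x hx y hy a b ha hb hab r hr
  have h1 := mul_le_mul_of_nonneg_left (hx r hr) ha
  have h2 := mul_le_mul_of_nonneg_left (hy r hr) hb
  simp only [Pi.add_apply, Pi.smul_apply, smul_eq_mul]
  have h3 : (r.2.2 : ℝ) = a * r.2.2 + b * r.2.2 := by rw [← add_mul, hab, one_mul]
  linarith

theorem latticeCell_mem_diffPolyhedron {R : Set (Fin k × Fin k × ℤ)} {v : Fin (m + 1) → Fin k → ℤ}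
    (h : ∀ j, (fun i => (v j i : ℝ)) ∈ diffPolyhedron R) (t) :
    (latticeCell v).toFun t ∈ diffPolyhedron R := by
  intro r hr
  simp only [latticeCell_apply]
  rw [← Finset.sum_sub_distrib]
  calc (r.2.2 : ℝ) = ∑ l, t l * (r.2.2 : ℝ) := by
        rw [← Finset.sum_mul, stdSimplex.sum_eq_one t, one_mul]
    _ ≤ _ := Finset.sum_le_sum fun l _ => by
        rw [← mul_sub]
        exact mul_le_mul_of_nonneg_left (h l r hr) (stdSimplex.zero_le t l)

/-- Integral bounds at `x` hold at the vertices of a simplex through `x`, and by convexity on the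
whole simplex. The closeness of the vertices to `x` later limits the number of simplices along a
segment. -/
theorem exists_latticeCell_mem_diffPolyhedron {R : Set (Fin k × Fin k × ℤ)} {x : Fin k → ℝ}
    (hx : x ∈ diffPolyhedron R) :
    ∃ (m : ℕ) (v : Fin (m + 1) → Fin k → ℤ) (t : stdSimplex ℝ (Fin (m + 1))), IsLatticeChain v ∧
      (latticeCell v).toFun t = x ∧ (∀ j i, |(v j i : ℝ) - x i| ≤ 1) ∧
      ∀ s, (latticeCell v).toFun s ∈ diffPolyhedron R := by
  obtain ⟨m, v, t, hv, ht, h1, h2⟩ := exists_latticeCell_apply_eq x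
  refine ⟨m, v, t, hv, ht, h1, latticeCell_mem_diffPolyhedron fun j r hr => ?_⟩
  have := h2 _ _ _ (hx r hr) j
  change (r.2.2 : ℝ) ≤ (v j r.1 : ℝ) - v j r.2.1
  exact_mod_cast this

/-- If `[a, 1]` is covered by finitely many closed sets, then a transitive relation that holds for
increasing pairs in each of them holds for `a` and `1`. -/
theorem rel_one_of_finite_closed_cover {ι : Type*} (P : unitInterval → unitInterval → Prop)
    (trans : ∀ a b c, P a b → P b c → P a c) (C : ι → Set unitInterval) (F : Finset ι) :
    (∀ i ∈ F, IsClosed (C i)) → (∀ i ∈ F, ∀ a ∈ C i, ∀ b ∈ C i, a ≤ b → P a b) →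
    ∀ a, Set.Ici a ⊆ (⋃ i ∈ F, C i) → P a 1 := by
  classical
  induction F using Finset.strongInduction with
  | H F ih =>
    intro hC hP a ha
    obtain ⟨i, hi, hai⟩ := Set.mem_iUnion₂.1 (ha (Set.mem_Ici.2 le_rfl))
    -- Go to the last point `b` of `C i`; beyond it this set is no longer needed, which allows the
    -- induction.
    obtain ⟨b, ⟨hb, hab⟩, hmax⟩ := (((hC i hi).inter isClosed_Ici).isCompact).exists_isGreatest
      ⟨a, hai, Set.mem_Ici.2 le_rfl⟩
    replace hab : a ≤ b := hab
    have hPab := hP i hi a hai b hb hab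
    rcases (unitInterval.le_one' (t := b)).eq_or_lt with rfl | hb1
    · exact hPab
    refine trans a b 1 hPab (ih (F.erase i) (Finset.erase_ssubset hi)
      (fun j hj => hC j (Finset.mem_of_mem_erase hj)) (fun j hj => hP j (Finset.mem_of_mem_erase hj))
      b ?_)
    have hcl : IsClosed (⋃ j ∈ F.erase i, C j) :=
      Set.Finite.isClosed_biUnion (Finset.finite_toSet _) fun j hj =>
        hC j (Finset.mem_of_mem_erase hj)
    have hIoi : Set.Ioi b ⊆ ⋃ j ∈ F.erase i, C j := by
      intro c hc
      obtain ⟨j, hj, hcj⟩ := Set.mem_iUnion₂.1 (ha (hab.trans (le_of_lt hc) : a ≤ c))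
      refine Set.mem_iUnion₂.2 ⟨j, Finset.mem_erase.2 ⟨?_, hj⟩, hcj⟩
      rintro rfl
      exact absurd (hmax ⟨hcj, hab.trans (le_of_lt hc)⟩) (not_le.2 hc)
    -- The other sets cover only what lies strictly beyond `b`; closedness adds `b` itself.
    rw [← closure_Ioi' (show (Set.Ioi b).Nonempty from ⟨1, hb1⟩)]
    exact hcl.closure_subset_iff.2 hIoi

theorem OrthoSystem.HasPath.trans {K : Type u} {S : OrthoSystem K} {x y z : K} {ℓ ℓ' : ℝ}
    (h : S.HasPath x y ℓ) (h' : S.HasPath y z ℓ') : S.HasPath x z (ℓ + ℓ') := by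
  induction h' with
  | refl => simpa using h
  | step σ hσ a b _ ih =>
    rw [← add_assoc]
    exact ih.step σ hσ a b

theorem toLp_lineMap (x y : Fin k → ℝ) (s : ℝ) :
    WithLp.toLp 2 (AffineMap.lineMap x y s) =
      AffineMap.lineMap (WithLp.toLp 2 x) (WithLp.toLp 2 y) s := by
  ext i
  simp [AffineMap.lineMap_apply]

/-- Straight segments in a polyhedron are piecewise affine paths in the lattice simplices that it
contains. -/
theorem hasPath_of_mem_diffPolyhedron {R : Set (Fin k × Fin k × ℤ)} {K : Type u}
    {T : OrthoSystem K} (g : diffPolyhedron R → K)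
    (hg : ∀ (m : ℕ) (v : Fin (m + 1) → Fin k → ℤ), IsLatticeChain v →
      ∀ h : ∀ t, (latticeCell v).toFun t ∈ diffPolyhedron R,
        (⟨fun t => g ⟨_, h t⟩, (latticeCell v).len⟩ : OrthoCell K m) ∈ T.cells m)
    (x y : diffPolyhedron R) :
    T.HasPath (g x) (g y) (dist (WithLp.toLp 2 x.1) (WithLp.toLp 2 y.1)) := by
  classical
  set d := dist (WithLp.toLp 2 x.1) (WithLp.toLp 2 y.1) with hd
  have hγmem (s : unitInterval) : AffineMap.lineMap x.1 y.1 (s : ℝ) ∈ diffPolyhedron R :=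
    (convex_diffPolyhedron R).lineMap_mem x.2 y.2 s.2
  let γ (s : unitInterval) : diffPolyhedron R := ⟨_, hγmem s⟩
  have hγc : Continuous fun s => (γ s).1 :=
    (AffineMap.lineMap_continuous (p := x.1) (q := y.1)).comp continuous_subtype_val
  obtain ⟨B, hB⟩ : ∃ B : ℝ, ∀ s i, |(γ s).1 i| ≤ B := by
    obtain ⟨B, hB⟩ := (isCompact_range hγc).isBounded.exists_norm_le
    exact ⟨B, fun s i => (norm_le_pi_norm (γ s).1 i).trans (hB _ ⟨s, rfl⟩)⟩
  -- Points of the segment have coordinates bounded by `B`, so simplices with vertices in this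
  -- finite box suffice. A chain is determined by its set of vertices, so there are finitely many.
  let I := {p : Σ m, Fin (m + 1) → Fin k → ℤ // IsLatticeChain p.2 ∧
    (∀ t, (latticeCell p.2).toFun t ∈ diffPolyhedron R) ∧
      ∀ j, p.2 j ∈ Set.Icc (fun _ => -⌈B + 1⌉) (fun _ => ⌈B + 1⌉)}
  have hfin : Finite I := by
    refine Finite.of_injective
      (β := Set (Set.Icc (fun _ : Fin k => -⌈B + 1⌉) (fun _ => ⌈B + 1⌉)))
      (fun p => {z | z.1 ∈ Set.range p.1.2}) ?_
    rintro ⟨⟨m, v⟩, hv, hvR, hvB⟩ ⟨⟨m', v'⟩, hv', hvR', hvB'⟩ h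
    have hr : Set.range v = Set.range v' := by
      ext z
      constructor
      · rintro ⟨j, rfl⟩
        exact (Set.ext_iff.1 h ⟨v j, hvB j⟩).mp ⟨j, rfl⟩
      · rintro ⟨j, rfl⟩
        exact (Set.ext_iff.1 h ⟨v' j, hvB' j⟩).mpr ⟨j, rfl⟩
    have hm : m + 1 = m' + 1 := by
      have h1 := Set.card_range_of_injective hv.strictMono.injective
      have h2 := Set.card_range_of_injective hv'.strictMono.injective
      simp only [Fintype.card_fin] at h1 h2
      rw [← h1, ← h2]
      exact Fintype.card_congr (Equiv.setCongr hr)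
    obtain rfl : m = m' := by omega
    obtain rfl := (hv.strictMono.range_inj hv'.strictMono).1 hr
    rfl
  have := Fintype.ofFinite I
  have key := rel_one_of_finite_closed_cover
    (fun a b => T.HasPath (g (γ a)) (g (γ b)) (((b : ℝ) - a) * d))
    (fun a b c h1 h2 => by convert h1.trans h2 using 1; ring)
    (fun p : I => {s | (γ s).1 ∈ Set.range (latticeCell p.1.2).toFun}) Finset.univ
    (fun p _ => ((isCompact_range (continuous_latticeCell p.1.2)).isClosed).preimage hγc) ?_ 0 ?_
  · have h0 : γ 0 = x := Subtype.ext (by simp [γ])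
    have h1 : γ 1 = y := Subtype.ext (by simp [γ])
    rw [h0, h1] at key
    simpa using key
  · rintro p - a ⟨s, hs⟩ b ⟨t, ht⟩ hab
    have hcell := hg _ p.1.2 p.2.1 p.2.2.1
    have hs' : g (γ a) = g ⟨_, p.2.2.1 s⟩ := congrArg g (Subtype.ext hs.symm)
    have ht' : g (γ b) = g ⟨_, p.2.2.1 t⟩ := congrArg g (Subtype.ext ht.symm)
    have hstep := OrthoSystem.HasPath.step (S := T) (x := g (γ a)) (ℓ := 0) _ hcell s t
      (by change T.HasPath _ (g ⟨_, p.2.2.1 s⟩) 0; rw [← hs']; exact .refl _)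
    have hdist : (latticeCell p.1.2).dist s t = ((b : ℝ) - a) * d := by
      rw [p.2.1.dist_eq, hs, ht, toLp_lineMap, toLp_lineMap, dist_lineMap_lineMap, Real.dist_eq,
        abs_sub_comm, abs_of_nonneg (sub_nonneg.2 (show (a : ℝ) ≤ b from hab))]
    change T.HasPath _ (g ⟨_, p.2.2.1 t⟩) (0 + (latticeCell p.1.2).dist s t) at hstep
    rw [← ht', zero_add, hdist] at hstep
    exact hstep
  · intro s _
    obtain ⟨m, v, t, hv, ht, h1, h2⟩ := exists_latticeCell_mem_diffPolyhedron (γ s).2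
    refine Set.mem_iUnion₂.2 ⟨⟨⟨m, v⟩, hv, h2, fun j => ?_⟩, Finset.mem_univ _, t, ht⟩
    have h3 (i) : |(v j i : ℝ)| ≤ ⌈B + 1⌉ := by
      have h4 := abs_sub_abs_le_abs_sub (v j i : ℝ) ((γ s).1 i)
      have h5 := h1 j i
      have h6 := hB s i
      have h7 := Int.le_ceil (B + 1)
      linarith
    exact ⟨fun i => by exact_mod_cast (abs_le.1 (h3 i)).1, fun i => by exact_mod_cast (abs_le.1 (h3 i)).2⟩

end Polyhedra

/-! ### Chambers of the configuration space -/

section Chambers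

variable {k m n : ℕ}

/-- The lifts to `ℝᵏ` of the configurations of points of the `n`-cycle with distances `≥ 1`. -/
def separatedTuples (k n : ℕ) : Set (Fin k → ℝ) :=
  {y | ∀ i j, i ≠ j → ∀ N : ℤ, 1 ≤ |y i - y j - n * N|}

/-- The tuples that are separated and ordered in the same way as `y`, relative to translations of
the entries by multiples of `n`. -/
def chamber (n : ℕ) (y : Fin k → ℝ) : Set (Fin k → ℝ) :=
  diffPolyhedron {r | r.1 ≠ r.2.1 ∧ ∃ N : ℤ, 0 < y r.1 - y r.2.1 - n * N ∧ r.2.2 = n * N + 1}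

theorem mem_chamber {y z : Fin k → ℝ} : z ∈ chamber n y ↔
    ∀ i j, i ≠ j → ∀ N : ℤ, 0 < y i - y j - n * N → 1 ≤ z i - z j - n * N := by
  constructor
  · intro h i j hij N hN
    have := h (i, j, n * N + 1) ⟨hij, N, hN, rfl⟩
    push_cast at this
    linarith
  · rintro h ⟨i, j, c⟩ ⟨hij, N, hN, hc⟩
    have := h i j hij N hN
    simp only at hc ⊢
    rw [hc]
    push_cast
    linarith

theorem convex_chamber (n : ℕ) (y : Fin k → ℝ) : Convex ℝ (chamber n y) := convex_diffPolyhedron _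

theorem mem_chamber_self {y : Fin k → ℝ} (hy : y ∈ separatedTuples k n) : y ∈ chamber n y :=
  mem_chamber.2 fun i j hij N hN => by
    have := hy i j hij N
    rwa [abs_of_pos hN] at this

/-- In a separated tuple all differences are nonzero modulo `n`. -/
theorem chamber_dichotomy {y z : Fin k → ℝ} (hy : y ∈ separatedTuples k n) (hz : z ∈ chamber n y)
    {i j : Fin k} (hij : i ≠ j) (N : ℤ) :
    (0 < y i - y j - n * N ∧ 1 ≤ z i - z j - n * N) ∨
      (y i - y j - n * N < 0 ∧ z i - z j - n * N ≤ -1) := by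
  rcases lt_trichotomy 0 (y i - y j - n * N) with h | h | h
  · exact Or.inl ⟨h, mem_chamber.1 hz i j hij N h⟩
  · have := hy i j hij N
    rw [← h] at this
    norm_num at this
  · have := mem_chamber.1 hz j i hij.symm (-N) (by push_cast; linarith)
    push_cast at this
    exact Or.inr ⟨h, by linarith⟩

theorem chamber_subset {y : Fin k → ℝ} (hy : y ∈ separatedTuples k n) :
    chamber n y ⊆ separatedTuples k n := fun z hz i j hij N => by
  rcases chamber_dichotomy hy hz hij N with h | h
  · exact h.2.trans (le_abs_self _)
  · exact (by linarith [h.2] : (1 : ℝ) ≤ -(z i - z j - n * N)).trans (neg_le_abs _)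

/-- All signs that define the chamber are constant on it. -/
theorem chamber_eq {y z : Fin k → ℝ} (hy : y ∈ separatedTuples k n) (hz : z ∈ chamber n y) :
    chamber n z = chamber n y := by
  ext w
  rw [mem_chamber, mem_chamber]
  refine forall₄_congr fun i j hij N => ?_
  have : 0 < z i - z j - n * N ↔ 0 < y i - y j - n * N := by
    rcases chamber_dichotomy hy hz hij N with h | h
    · exact ⟨fun _ => h.1, fun _ => by linarith [h.2]⟩
    · exact ⟨fun h' => by linarith [h.2], fun h' => by linarith [h.1]⟩
  rw [this]

/-- The differences change by less than 1 and avoid `(-1, 1)` at both tuples, so a positive one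
stays positive. -/
theorem mem_chamber_of_abs_sub_lt {y z : Fin k → ℝ} (hy : y ∈ separatedTuples k n)
    (hz : z ∈ separatedTuples k n) (h : ∀ i, |z i - y i| < 1 / 2) : z ∈ chamber n y := by
  refine mem_chamber.2 fun i j hij N hN => ?_
  have h1 := hy i j hij N
  rw [abs_of_pos hN] at h1
  have h2 := hz i j hij N
  have h3 := abs_lt.1 (h i)
  have h4 := abs_lt.1 (h j)
  rwa [abs_of_pos (by linarith [h3.1, h4.2])] at h2

/-! ### The configuration space as the image of the separated tuples -/

theorem wrap_mem_thickDiag {y : Fin k → ℝ} : wrap n y ∈ thickDiag k (AddCircle (n : ℝ)) ↔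
    ∃ i j, i ≠ j ∧ ∃ N : ℤ, y i - y j - n * N = 0 := by
  refine exists₂_congr fun i j => and_congr_right fun _ => ?_
  rw [wrap, wrap, ← sub_eq_zero, ← AddCircle.coe_sub, AddCircle.coe_eq_zero_iff]
  refine exists_congr fun N => ?_
  rw [zsmul_eq_mul, mul_comm, eq_comm, sub_eq_zero]

/-- Only the vertices matter. From `v 0` to `v a` a difference drops by at most 1, so a positive
integer becomes nonnegative, and being nonzero it is at least 1. The bounds extend to the simplex by
convexity. -/
theorem IsLatticeChain.mem_chamber_of_avoids {v : Fin (m + 1) → Fin k → ℤ} (hv : IsLatticeChain v)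
    (h : ∀ j, wrap n (fun i => (v j i : ℝ)) ∉ thickDiag k (AddCircle (n : ℝ))) :
    (fun i => (v 0 i : ℝ)) ∈ separatedTuples k n ∧
      ∀ t, (latticeCell v).toFun t ∈ chamber n fun i => (v 0 i : ℝ) := by
  have hne (a) (i j) (hij : i ≠ j) (N : ℤ) : v a i - v a j - n * N ≠ 0 := fun h0 =>
    h a (wrap_mem_thickDiag.2 ⟨i, j, hij, N, by exact_mod_cast h0⟩)
  constructor
  · intro i j hij N
    have := Int.one_le_abs (hne 0 i j hij N)
    beta_reduce
    exact_mod_cast this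
  · refine latticeCell_mem_diffPolyhedron fun a => ?_
    change (fun i => (v a i : ℝ)) ∈ chamber n fun i => (v 0 i : ℝ)
    refine mem_chamber.2 fun i j hij N h0 => ?_
    beta_reduce at h0 ⊢
    have h1 := hne a i j hij N
    have h2 := hv.zero_le a i
    have h3 := hv.le_add_one 0 a j
    have h4 : 0 < v 0 i - v 0 j - n * N := by exact_mod_cast h0
    have h5 : 1 ≤ v a i - v a j - n * N := by omega
    exact_mod_cast h5

theorem wrap_notMem_thickDiag {y : Fin k → ℝ} (hy : y ∈ separatedTuples k n) :
    wrap n y ∉ thickDiag k (AddCircle (n : ℝ)) := fun h => by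
  obtain ⟨i, j, hij, N, h0⟩ := wrap_mem_thickDiag.1 h
  have := hy i j hij N
  rw [h0] at this
  norm_num at this

theorem IsLatticeChain.avoidsDiag_iff {v : Fin (m + 1) → Fin k → ℤ} (hv : IsLatticeChain v) :
    AvoidsDiag k m ((latticeCell v).map (wrap n)) ↔
      ∀ t, (latticeCell v).toFun t ∈ separatedTuples k n := by
  constructor
  · intro h
    have h1 := hv.mem_chamber_of_avoids (n := n) fun j hj => by
      refine Set.disjoint_left.1 h ⟨stdSimplex.vertex j, ?_⟩ hj
      exact congrArg (wrap n) (latticeCell_vertex v j)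
    exact fun t => chamber_subset h1.1 (h1.2 t)
  · intro h
    refine Set.disjoint_left.2 ?_
    rintro _ ⟨t, rfl⟩
    exact wrap_notMem_thickDiag (h t)

theorem chamber_latticeCell {v : Fin (m + 1) → Fin k → ℤ} (hv : IsLatticeChain v)
    (h : ∀ t, (latticeCell v).toFun t ∈ separatedTuples k n) (s t) :
    (latticeCell v).toFun t ∈ chamber n ((latticeCell v).toFun s) := by
  have h1 := hv.mem_chamber_of_avoids (n := n) fun j hj => by
    have := latticeCell_vertex v j
    rw [← this] at hj
    exact wrap_notMem_thickDiag (h _) hj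
  rw [chamber_eq h1.1 (h1.2 s)]
  exact h1.2 t

/-- A separated tuple lies in its own chamber, and the integral bounds of the chamber provide a
simplex of separated tuples through it. -/
theorem wrap_mem_confSpace {y : Fin k → ℝ} :
    wrap n y ∈ ((cycle n).prod k).support (AvoidsDiag k) ↔ y ∈ separatedTuples k n := by
  constructor
  · rintro ⟨m, σ, hσ, hP, t, ht⟩
    obtain ⟨v, hv, rfl, rfl⟩ := exists_latticeCell_through hσ ht.symm
    exact hv.avoidsDiag_iff.1 hP t
  · intro hy
    obtain ⟨m, v, t, hv, rfl, -, h⟩ := exists_latticeCell_mem_diffPolyhedron (mem_chamber_self hy)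
    exact ⟨m, _, mem_cycle_prod_cells.2 ⟨v, hv, rfl⟩,
      hv.avoidsDiag_iff.2 fun t => chamber_subset hy (h t), t, rfl⟩

/-- The projection to the configuration space. -/
def confProj (k n : ℕ) (y : separatedTuples k n) : ConfSpace k (cycle n) :=
  ⟨wrap n y.1, wrap_mem_confSpace.2 y.2⟩

theorem confProj_surjective (k n : ℕ) : Function.Surjective (confProj k n) := by
  rintro ⟨x, hx⟩
  obtain ⟨y, rfl⟩ := wrap_surjective n x
  exact ⟨⟨y, wrap_mem_confSpace.1 hx⟩, rfl⟩

theorem confProj_eq_iff {y z : separatedTuples k n} : confProj k n y = confProj k n z ↔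
    ∃ N : Fin k → ℤ, ∀ i, y.1 i = z.1 i + n * N i := by
  rw [← wrap_eq_wrap_iff]
  exact Subtype.ext_iff

theorem mem_conf_cells {v : Fin (m + 1) → Fin k → ℤ} (hv : IsLatticeChain v)
    (h : ∀ t, (latticeCell v).toFun t ∈ separatedTuples k n) :
    (⟨fun t => confProj k n ⟨_, h t⟩, (latticeCell v).len⟩ : OrthoCell _ m) ∈
      (conf k (cycle n)).cells m :=
  ⟨mem_cycle_prod_cells.2 ⟨v, hv, rfl⟩, hv.avoidsDiag_iff.2 h⟩

/-- The simplices of the configuration space lift to every lift of one of their points. -/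
theorem exists_lift_of_mem_conf_cells {σ : OrthoCell (ConfSpace k (cycle n)) m}
    (hσ : σ ∈ (conf k (cycle n)).cells m) {t : stdSimplex ℝ (Fin (m + 1))}
    {y : separatedTuples k n} (h : confProj k n y = σ.toFun t) :
    ∃ v, IsLatticeChain v ∧ (latticeCell v).toFun t = y ∧
      ∃ hs : ∀ s, (latticeCell v).toFun s ∈ separatedTuples k n,
        σ = ⟨fun s => confProj k n ⟨_, hs s⟩, (latticeCell v).len⟩ := by
  obtain ⟨v, hv, hvt, hσv⟩ := exists_latticeCell_through hσ.1 (congrArg Subtype.val h)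
  have hP := hσ.2
  rw [hσv] at hP
  exact ⟨v, hv, hvt, hv.avoidsDiag_iff.1 hP, OrthoCell.map_injective Subtype.val_injective hσv⟩

/-! ### Pushing down and lifting piecewise affine paths -/

theorem conf_hasPath {y z : separatedTuples k n} (hz : z.1 ∈ chamber n y.1) :
    (conf k (cycle n)).HasPath (confProj k n y) (confProj k n z)
      (dist (WithLp.toLp 2 y.1) (WithLp.toLp 2 z.1)) :=
  hasPath_of_mem_diffPolyhedron (fun w : chamber n y.1 => confProj k n ⟨w.1, chamber_subset y.2 w.2⟩)
    (fun _ _ hv h => mem_conf_cells hv fun t => chamber_subset y.2 (h t))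
    ⟨y.1, mem_chamber_self y.2⟩ ⟨z.1, hz⟩

/-- Each segment lies in a simplex that lifts isometrically through the endpoint reached so far and
stays in one chamber. The triangle inequality bounds the total displacement. -/
theorem exists_of_conf_hasPath {y : separatedTuples k n} {x : ConfSpace k (cycle n)} {ℓ : ℝ}
    (h : (conf k (cycle n)).HasPath (confProj k n y) x ℓ) :
    ∃ z : separatedTuples k n, z.1 ∈ chamber n y.1 ∧ confProj k n z = x ∧
      dist (WithLp.toLp 2 y.1) (WithLp.toLp 2 z.1) ≤ ℓ := by
  generalize hx0 : confProj k n y = x0 at h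
  induction h with
  | refl => exact ⟨y, mem_chamber_self y.2, hx0, by simp⟩
  | step σ hσ a b _ ih =>
    obtain ⟨z, hz, hzσ, hd⟩ := ih
    obtain ⟨v, hv, hva, hs, rfl⟩ := exists_lift_of_mem_conf_cells hσ hzσ
    refine ⟨⟨_, hs b⟩, ?_, rfl, (dist_triangle _ (WithLp.toLp 2 z.1) _).trans (add_le_add hd ?_)⟩
    · rw [← chamber_eq y.2 hz, ← hva]
      exact chamber_latticeCell hv hs a b
    · rw [← hva]
      exact (hv.dist_eq a b).ge

/-- The projection to the unlabeled configuration space. -/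
def uconfProj (k n : ℕ) (y : separatedTuples k n) : Quotient (confSetoid k (cycle n)) :=
  Quotient.mk _ (confProj k n y)

theorem uconfProj_surjective (k n : ℕ) : Function.Surjective (uconfProj k n) :=
  Quotient.mk_surjective.comp (confProj_surjective k n)

theorem OrthoSystem.HasPath.map {K : Type u} {L : Type v} {S : OrthoSystem K} (f : K → L) {x y : K}
    {ℓ : ℝ} (h : S.HasPath x y ℓ) : (S.map f).HasPath (f x) (f y) ℓ := by
  induction h with
  | refl => exact .refl _
  | step σ hσ a b _ ih => exact ih.step (S := S.map f) (σ.map f) ⟨σ, hσ, rfl⟩ a b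

theorem uconf_hasPath {y z : separatedTuples k n} (hz : z.1 ∈ chamber n y.1) :
    (uconf k (cycle n)).HasPath (uconfProj k n y) (uconfProj k n z)
      (dist (WithLp.toLp 2 y.1) (WithLp.toLp 2 z.1)) :=
  (conf_hasPath hz).map _

theorem exists_of_uconf_hasPath {y : separatedTuples k n} {x : Quotient (confSetoid k (cycle n))}
    {ℓ : ℝ} (h : (uconf k (cycle n)).HasPath (uconfProj k n y) x ℓ) :
    ∃ z : separatedTuples k n, z.1 ∈ chamber n y.1 ∧ uconfProj k n z = x ∧
      dist (WithLp.toLp 2 y.1) (WithLp.toLp 2 z.1) ≤ ℓ := by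
  generalize hx0 : uconfProj k n y = x0 at h
  induction h with
  | refl => exact ⟨y, mem_chamber_self y.2, hx0, by simp⟩
  | step σ hσ a b _ ih =>
    obtain ⟨z, hz, hzσ, hd⟩ := ih
    obtain ⟨τ, hτ, rfl⟩ := hσ
    -- The labeled simplex `τ` meets the configuration of `z` only up to relabeling; its relabeled
    -- copy has the same edge lengths and can be lifted.
    obtain ⟨π, hπ⟩ := (confSetoid k (cycle n)).symm (Quotient.exact hzσ)
    have hzτ : confProj k n z = (τ.map (confPerm π)).toFun a := Subtype.ext hπ
    obtain ⟨v, hv, hva, hs, hτv⟩ := exists_lift_of_mem_conf_cells (conf_perm π hτ) hzτ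
    have hτb : confProj k n ⟨_, hs b⟩ = confPerm π (τ.toFun b) :=
      (congrFun (congrArg OrthoCell.toFun hτv) b).symm
    have hlen : τ.len = (latticeCell v).len := congrArg OrthoCell.len hτv
    refine ⟨⟨_, hs b⟩, ?_, ?_, (dist_triangle _ (WithLp.toLp 2 z.1) _).trans (add_le_add hd ?_)⟩
    · rw [← chamber_eq y.2 hz, ← hva]
      exact chamber_latticeCell hv hs a b
    · rw [uconfProj, hτb]
      exact (Quotient.sound ⟨π, rfl⟩ : (⟦τ.toFun b⟧ : Quotient (confSetoid k (cycle n))) = _).symm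
    · rw [← hva, ← hv.dist_eq a b]
      simp only [OrthoCell.dist, OrthoCell.map, hlen, le_refl]

/-- Different tuples with the same unlabeled configuration are at distance at least `1 / 2`. -/
theorem eq_of_uconfProj_eq (hn : 0 < n) {y z : separatedTuples k n}
    (h : uconfProj k n y = uconfProj k n z)
    (hd : dist (WithLp.toLp 2 y.1) (WithLp.toLp 2 z.1) < 1 / 2) : y = z := by
  obtain ⟨π, hπ⟩ := Quotient.exact h
  have hπ' : wrap n z.1 = wrap n (y.1 ∘ π) := hπ
  obtain ⟨N, hN⟩ := wrap_eq_wrap_iff.1 hπ'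
  have hle (i) : |y.1 i - z.1 i| < 1 / 2 := by
    refine lt_of_le_of_lt ?_ hd
    rw [dist_eq_norm, ← Real.norm_eq_abs]
    exact PiLp.norm_apply_le (WithLp.toLp 2 y.1 - WithLp.toLp 2 z.1) i
  ext i
  -- Otherwise `z i` is a translate of another entry of `y`, which by separation is at least 1 away
  -- from `y i`.
  have hπi : π i = i := by
    by_contra hne
    have h1 := y.2 i (π i) (Ne.symm hne) (N i)
    have h2 := hle i
    rw [hN i, Function.comp, ← sub_sub] at h2
    linarith
  have h3 := hN i
  rw [Function.comp, hπi] at h3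
  have h4 := abs_lt.1 (hle i)
  have hn' : (1 : ℝ) ≤ n := by exact_mod_cast hn
  have h5 : N i = 0 := by
    by_contra hne
    have h6 : (1 : ℝ) ≤ |(N i : ℝ)| := by exact_mod_cast Int.one_le_abs hne
    have h7 : 1 ≤ |(n : ℝ) * N i| := by
      rw [abs_mul, abs_of_nonneg (by linarith : (0 : ℝ) ≤ n)]
      exact one_le_mul_of_one_le_of_one_le hn' h6
    have h8 := abs_lt.2 h4
    rw [h3, show y.1 i - (y.1 i + n * N i) = -(n * N i) by ring, abs_neg] at h8
    linarith
  rw [h3, h5]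
  simp

theorem eq_of_confProj_eq (hn : 0 < n) {y z : separatedTuples k n}
    (h : confProj k n y = confProj k n z)
    (hd : dist (WithLp.toLp 2 y.1) (WithLp.toLp 2 z.1) < 1 / 2) : y = z :=
  eq_of_uconfProj_eq hn (congrArg (Quotient.mk _) h) hd

/-! ### The column as a polyhedron -/

/-- The inequalities `x₁ < ⋯ < xₖ < x₁ + n`, for integers. -/
def columnBounds (k n : ℕ) : Set (Fin k × Fin k × ℤ) :=
  {r | (r.2.1 < r.1 ∧ r.2.2 = 1) ∨ r.2.2 = 1 - n}

theorem mem_diffPolyhedron_columnBounds {x : Fin k → ℝ} :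
    x ∈ diffPolyhedron (columnBounds k n) ↔
      (∀ i j, i < j → 1 ≤ x j - x i) ∧ ∀ i j, 1 - (n : ℝ) ≤ x i - x j := by
  constructor
  · intro h
    constructor
    · intro i j hij
      have := h (j, i, 1) (Or.inl ⟨hij, rfl⟩)
      push_cast at this
      exact this
    · intro i j
      have := h (i, j, 1 - n) (Or.inr rfl)
      push_cast at this
      exact this
  · rintro h ⟨i, j, c⟩ (⟨h1, h2⟩ | h2)
    · simp only at h1 h2 ⊢
      rw [h2]
      exact_mod_cast h.1 _ _ h1
    · simp only at h2 ⊢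
      rw [h2]
      push_cast
      exact h.2 i j

/-- Between integers a strict inequality gains 1, so the vertex conditions become closed integral
bounds, which are preserved by convex combinations. -/
theorem inColumn_latticeCell {v : Fin (m + 1) → Fin k → ℤ} :
    InColumn k n m (latticeCell v) ↔
      ∀ t, (latticeCell v).toFun t ∈ diffPolyhedron (columnBounds k n) := by
  constructor
  · intro h
    refine latticeCell_mem_diffPolyhedron fun j => mem_diffPolyhedron_columnBounds.2 ?_
    have h1 := h j
    rw [latticeCell_vertex] at h1
    beta_reduce at h1 ⊢
    constructor
    · intro a b hab
      have h2 : v j a < v j b := Int.cast_lt.1 (h1.1 hab)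
      have h3 : 1 ≤ v j b - v j a := by omega
      exact_mod_cast h3
    · intro a b
      have h2 : v j b < v j a + n := by exact_mod_cast h1.2 a b
      have h3 : 1 - (n : ℤ) ≤ v j a - v j b := by omega
      exact_mod_cast h3
  · intro h j
    have h1 := mem_diffPolyhedron_columnBounds.1 (h (stdSimplex.vertex j))
    refine ⟨fun a b hab => ?_, fun a b => ?_⟩
    · have := h1.1 a b hab
      simp only [OrthoCell.vertex]
      linarith
    · have := h1.2 a b
      simp only [OrthoCell.vertex]
      linarith

theorem support_inColumn (k n : ℕ) :
    (line.prod k).support (InColumn k n) = diffPolyhedron (columnBounds k n) := by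
  ext x
  constructor
  · rintro ⟨m, σ, hσ, hP, t, rfl⟩
    obtain ⟨v, hv, rfl⟩ := mem_line_prod_cells.1 hσ
    exact inColumn_latticeCell.1 hP t
  · intro hx
    obtain ⟨m, v, t, hv, rfl, -, h⟩ := exists_latticeCell_mem_diffPolyhedron hx
    exact ⟨m, _, mem_line_prod_cells.2 ⟨v, hv, rfl⟩, inColumn_latticeCell.2 h, t, rfl⟩

/-- The vertices of a lattice simplex inside the column are points of the polyhedron, so fullness is
automatic. -/
theorem mem_column_cells {σ : OrthoCell (ColumnSpace k n) m} :
    σ ∈ (column k n).cells m ↔ ∃ v, IsLatticeChain v ∧ σ.map Subtype.val = latticeCell v := by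
  constructor
  · rintro ⟨h, -⟩
    exact mem_line_prod_cells.1 h
  · rintro ⟨v, hv, h⟩
    refine ⟨mem_line_prod_cells.2 ⟨v, hv, h⟩, ?_⟩
    rw [h]
    refine inColumn_latticeCell.2 fun t => ?_
    rw [← support_inColumn, ← h]
    exact (σ.toFun t).2

/-- Segments stay in the convex column, which bounds the length metric above; each step of a path is
Euclidean, so the triangle inequality bounds it below. -/
theorem column_edist (x y : ColumnSpace k n) :
    (column k n).edist x y = edist (WithLp.toLp 2 x.1) (WithLp.toLp 2 y.1) := by
  rw [edist_dist]
  refine le_antisymm ?_ (le_iInf₂ fun ℓ hℓ => ENNReal.ofReal_le_ofReal ?_)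
  · refine iInf₂_le _ ?_
    have hsub : diffPolyhedron (columnBounds k n) ⊆ (line.prod k).support (InColumn k n) :=
      (support_inColumn k n).ge
    have hsup : (line.prod k).support (InColumn k n) ⊆ diffPolyhedron (columnBounds k n) :=
      (support_inColumn k n).le
    exact hasPath_of_mem_diffPolyhedron (T := column k n)
      (fun z : diffPolyhedron (columnBounds k n) => ⟨z.1, hsub z.2⟩)
      (fun _ v hv _ => mem_column_cells.2 ⟨v, hv, rfl⟩) ⟨x.1, hsup x.2⟩ ⟨y.1, hsup y.2⟩
  · induction hℓ with
    | refl => simp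
    | step σ hσ a b _ ih =>
      refine (dist_triangle _ _ _).trans (add_le_add ih ?_)
      obtain ⟨v, hv, h⟩ := mem_column_cells.1 hσ
      have h1 := (hv.dist_eq a b).ge
      rw [← h] at h1
      exact h1

end Chambers

/-! ### Curvature -/

section Curvature

/-- By the law of cosines the inner product of `y - x` and `z - x` depends only on the three side
lengths. Hence the comparison inequality is an equality in Euclidean spaces. -/
theorem dist_lineMap_lineMap_sq {V : Type*} [NormedAddCommGroup V] [InnerProductSpace ℝ V]
    (x y z : V) (s t : ℝ) :
    dist (AffineMap.lineMap x y s) (AffineMap.lineMap x z t) ^ 2 =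
      s ^ 2 * dist x y ^ 2 + t ^ 2 * dist x z ^ 2 -
        s * t * (dist x y ^ 2 + dist x z ^ 2 - dist y z ^ 2) := by
  have h1 : (AffineMap.lineMap x y s : V) - AffineMap.lineMap x z t =
      s • (y - x) - t • (z - x) := by
    simp [AffineMap.lineMap_apply]
  have h2 : dist y z ^ 2 = ‖y - x‖ ^ 2 - 2 * inner ℝ (y - x) (z - x) + ‖z - x‖ ^ 2 := by
    rw [← norm_sub_sq_real, sub_sub_sub_cancel_right, dist_eq_norm]
  rw [h2, dist_eq_norm, h1, dist_comm x y, dist_comm x z, dist_eq_norm y x, dist_eq_norm z x,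
    norm_sub_sq_real, norm_smul, norm_smul, real_inner_smul_left, real_inner_smul_right, mul_pow,
    mul_pow, Real.norm_eq_abs, Real.norm_eq_abs, sq_abs, sq_abs]
  ring

theorem edist_lineMap_lineMap_congr {V W : Type*} [NormedAddCommGroup V] [InnerProductSpace ℝ V]
    [NormedAddCommGroup W] [InnerProductSpace ℝ W] {x y z : V} {x' y' z' : W}
    (h1 : edist x' y' = edist x y) (h2 : edist x' z' = edist x z) (h3 : edist y' z' = edist y z)
    (s t : ℝ) :
    edist (AffineMap.lineMap x y s) (AffineMap.lineMap x z t) =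
      edist (AffineMap.lineMap x' y' s) (AffineMap.lineMap x' z' t) := by
  have key {a b : V} {a' b' : W} (h : edist a' b' = edist a b) : dist a' b' = dist a b := by
    rw [dist_edist, dist_edist, h]
  rw [edist_dist, edist_dist]
  congr 1
  rw [← sq_eq_sq₀ dist_nonneg dist_nonneg, dist_lineMap_lineMap_sq, dist_lineMap_lineMap_sq,
    key h1, key h2, key h3]

/-- A set that is identified with a convex set in a Euclidean space is `CAT(0)`. -/
theorem isCAT0_of_convex_range {X : Type u} {V : Type*} [NormedAddCommGroup V]
    [InnerProductSpace ℝ V] {d : X → X → ℝ≥0∞} (φ : X → V) (hinj : Function.Injective φ)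
    (hφ : Convex ℝ (Set.range φ)) (hd : ∀ x y, d x y = edist (φ x) (φ y)) : IsCAT0 d := by
  -- Geodesics become segments: a point whose distances to the ends are the fractions `s` and `1 -
  -- s` of the total lies on the segment.
  have hgeo {x y : X} {γ : unitInterval → X} (hγ : IsGeodesic d x y γ) (s : unitInterval) :
      φ (γ s) = AffineMap.lineMap (φ x) (φ y) (s : ℝ) := by
    obtain ⟨h0, h1, h⟩ := hγ
    have hdist (a b : unitInterval) :
        dist (φ (γ a)) (φ (γ b)) = |(a : ℝ) - b| * dist (φ x) (φ y) := by
      have := h a b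
      rw [hd, hd, edist_dist, edist_dist, ← ENNReal.ofReal_mul (abs_nonneg _),
        ENNReal.ofReal_eq_ofReal_iff dist_nonneg (by positivity)] at this
      exact this
    refine eq_lineMap_of_dist_eq_mul_of_dist_eq_mul ?_ ?_
    · have := hdist 0 s
      rw [h0] at this
      rw [this, Set.Icc.coe_zero, zero_sub, abs_neg, abs_of_nonneg s.2.1]
    · have := hdist s 1
      rw [h1] at this
      rw [this, Set.Icc.coe_one, abs_sub_comm, abs_of_nonneg (sub_nonneg.2 s.2.2)]
  refine ⟨⟨fun x y => ?_, fun x y => ?_, fun x y z => ?_⟩, fun x y => ?_, fun x y => ?_, ?_⟩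
  · rw [hd, edist_eq_zero, hinj.eq_iff]
  · rw [hd, hd, edist_comm]
  · rw [hd, hd, hd]
    exact edist_triangle _ _ _
  · rw [hd]
    exact edist_ne_top _ _
  · choose γ hγ using fun s : unitInterval =>
      hφ.lineMap_mem (Set.mem_range_self x) (Set.mem_range_self y) s.2
    refine ⟨γ, hinj (by simp [hγ]), hinj (by simp [hγ]), fun s t => ?_⟩
    rw [hd, hd, hγ, hγ, edist_dist, edist_dist, dist_lineMap_lineMap,
      ENNReal.ofReal_mul dist_nonneg, Real.dist_eq]
  · intro x y z γ η hγ hη x' y' z' h1 h2 h3 s t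
    rw [hd] at h1 h2 h3
    rw [hd, hgeo hγ, hgeo hη]
    exact (edist_lineMap_lineMap_congr h1 h2 h3 s t).le

theorem OrthoSystem.edist_triangle {X : Type u} (S : OrthoSystem X) (x y z : X) :
    S.edist x z ≤ S.edist x y + S.edist y z := by
  simp only [OrthoSystem.edist, ENNReal.iInf_add, ENNReal.add_iInf]
  exact le_iInf₂ fun ℓ h => le_iInf₂ fun ℓ' h' =>
    (iInf₂_le (ℓ' + ℓ) (h'.trans h)).trans ENNReal.ofReal_add_le

variable {X : Type u} {Y : Type v} {V : Type*} [NormedAddCommGroup V] [InnerProductSpace ℝ V]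

/-- Suppose that `p : Y → X` lifts piecewise affine paths, where the space `Y` is divided into
pieces (the classes of `r`) that are convex sets in a Euclidean space, and that the fibres of `p`
are separated in each piece.  Then the length pseudometric of `X` is non-positively curved. -/
theorem isNonpositivelyCurved_of_path_lifting {S : OrthoSystem X} (p : Y → X)
    (hp : Function.Surjective p) (φ : Y → V) (hinj : Function.Injective φ) (r : Setoid Y)
    (hconv : ∀ y, Convex ℝ (φ '' {z | r y z}))
    (hpath : ∀ y z, r y z → S.HasPath (p y) (p z) (dist (φ y) (φ z)))
    (hlift : ∀ y x ℓ, S.HasPath (p y) x ℓ → ∃ z, r y z ∧ p z = x ∧ dist (φ y) (φ z) ≤ ℓ)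
    {δ : ℝ} (hδ : 0 < δ) (hsep : ∀ y z, p y = p z → dist (φ y) (φ z) < δ → y = z) :
    IsNonpositivelyCurved S.edist := by
  have hle {y z} (h : r y z) : S.edist (p y) (p z) ≤ edist (φ y) (φ z) := by
    rw [edist_dist]
    exact iInf₂_le _ (hpath y z h)
  have hex {y x} {ε : ℝ≥0∞} (h : S.edist (p y) x < ε) :
      ∃ z, r y z ∧ p z = x ∧ edist (φ y) (φ z) < ε := by
    rw [OrthoSystem.edist] at h
    obtain ⟨ℓ, hℓ⟩ := iInf_lt_iff.1 h
    obtain ⟨hℓ, hlt⟩ := iInf_lt_iff.1 hℓ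
    obtain ⟨z, hz, hzx, hdz⟩ := hlift y x ℓ hℓ
    refine ⟨z, hz, hzx, lt_of_le_of_lt ?_ hlt⟩
    rw [edist_dist]
    exact ENNReal.ofReal_le_ofReal hdz
  have hsep' {y z} (h : p y = p z) (hd : edist (φ y) (φ z) < ENNReal.ofReal δ) : y = z := by
    refine hsep y z h ?_
    rwa [edist_dist, ENNReal.ofReal_lt_ofReal_iff hδ] at hd
  -- Symmetry is taken from the Euclidean distance upstairs, so no path has to be reversed.
  have hsymm_le (x x') : S.edist x' x ≤ S.edist x x' := by
    obtain ⟨y, rfl⟩ := hp x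
    refine le_of_forall_gt fun ε hε => ?_
    obtain ⟨z, hz, rfl, hd⟩ := hex hε
    refine (hle (r.symm hz)).trans_lt ?_
    rwa [edist_comm]
  have hmetric : IsExtMetric S.edist := by
    refine ⟨fun x x' => ?_, fun x x' => le_antisymm (hsymm_le _ _) (hsymm_le _ _), S.edist_triangle⟩
    · obtain ⟨y, rfl⟩ := hp x
      constructor
      · intro h0
        obtain ⟨z, hz, rfl, hd⟩ := hex (h0.trans_lt (ENNReal.ofReal_pos.2 (half_pos hδ)))
        suffices h : ∀ ε, 0 < ε → edist (φ y) (φ z) ≤ ε by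
          have h1 : edist (φ y) (φ z) = 0 := le_antisymm (le_of_forall_gt_imp_ge_of_dense h) bot_le
          rw [hinj (edist_eq_zero.1 h1)]
        intro ε hε
        -- Arbitrarily short paths lift to endpoints over the same point; separation forces them all
        -- to be `z`.
        obtain ⟨w, hw, hwz, hdw⟩ := hex
          (h0.trans_lt (lt_min hε (ENNReal.ofReal_pos.2 (half_pos hδ))))
        have hzw : w = z := by
          refine hsep' hwz ?_
          refine (edist_triangle_left (φ w) (φ z) (φ y)).trans_lt ?_
          rw [← add_halves δ, ENNReal.ofReal_add (half_pos hδ).le (half_pos hδ).le]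
          exact ENNReal.add_lt_add (hdw.trans_le (min_le_right _ _)) hd
        rw [← hzw]
        exact (hdw.trans_le (min_le_left _ _)).le
      · rintro rfl
        refine le_antisymm ((hle (r.refl y)).trans ?_) bot_le
        rw [edist_self]
  refine ⟨hmetric, fun x => ?_⟩
  obtain ⟨y, rfl⟩ := hp x
  -- Lifts of two points of the ball are less than `2 ρ` apart. Comparing two lifts of one point
  -- through a third then needs `4 ρ = δ`.
  set ρ := δ / 4 with hρ
  have hρ0 : 0 < ρ := by positivity
  refine ⟨ρ, hρ0, ?_⟩
  choose s hs1 hs2 hs3 using fun z : {z : X // S.edist (p y) z < ENNReal.ofReal ρ} => hex z.2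
  refine isCAT0_of_convex_range (fun z => φ (s z)) (fun z w h => ?_) ?_ fun z w => ?_
  · have := hinj h
    exact Subtype.ext (by rw [← hs2 z, ← hs2 w, this])
  · have : Set.range (fun z => φ (s z)) = φ '' {z | r y z} ∩ Metric.eball (φ y) (ENNReal.ofReal ρ) := by
      ext v
      constructor
      · rintro ⟨z, rfl⟩
        exact ⟨⟨_, hs1 z, rfl⟩, by rw [Metric.mem_eball, edist_comm]; exact hs3 z⟩
      · rintro ⟨⟨z, hz, rfl⟩, hv⟩
        rw [Metric.mem_eball, edist_comm] at hv
        refine ⟨⟨p z, (hle hz).trans_lt hv⟩, congrArg φ (hsep' (hs2 _) ?_)⟩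
        refine (edist_triangle_left _ _ (φ y)).trans_lt ?_
        refine (ENNReal.add_lt_add (hs3 _) hv).trans_le ?_
        rw [← ENNReal.ofReal_add hρ0.le hρ0.le]
        exact ENNReal.ofReal_le_ofReal (by rw [hρ]; linarith)
    rw [this, Metric.eball_ofReal]
    exact (hconv y).inter (convex_ball _ _)
  · refine le_antisymm ?_ (le_of_forall_gt fun ε hε => ?_)
    · have h := hle (r.trans (r.symm (hs1 z)) (hs1 w))
      rwa [hs2, hs2] at h
    · have hρ2 : ENNReal.ofReal ρ + ENNReal.ofReal ρ + (ENNReal.ofReal ρ + ENNReal.ofReal ρ) =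
          ENNReal.ofReal δ := by
        rw [← ENNReal.ofReal_add hρ0.le hρ0.le, ← ENNReal.ofReal_add (by positivity) (by positivity)]
        congr 1
        rw [hρ]; ring
      have hzw : edist (φ (s z)) (φ (s w)) < ENNReal.ofReal ρ + ENNReal.ofReal ρ :=
        (edist_triangle_left _ _ (φ y)).trans_lt (ENNReal.add_lt_add (hs3 z) (hs3 w))
      have hε' : S.edist (p (s z)) w.1 < ε := by rwa [hs2 z]
      obtain ⟨v, hv, hvw, hd⟩ := hex hε'
      -- A lift of the path ending near `s z` must end at `s w`; one ending at distance `2 ρ` or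
      -- more is longer than the segment to `s w`.
      rcases lt_or_ge (edist (φ (s z)) (φ v)) (ENNReal.ofReal ρ + ENNReal.ofReal ρ) with h | h
      · have : s w = v := by
          refine hsep' ((hs2 w).trans hvw.symm) ?_
          refine (edist_triangle_left _ _ (φ (s z))).trans_lt ?_
          rw [← hρ2]
          exact ENNReal.add_lt_add hzw h
        rwa [this]
      · exact hzw.trans_le (h.trans hd.le)

end Curvature

/-! ### The universal cover -/

section Covering

open Topology

variable {k m n : ℕ} {i₀ : Fin k}

/-- The separated tuples whose entries lie in `[x, x + n)`, where `x` is the `i₀`-th entry. -/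
def normalizedTuples (n : ℕ) (i₀ : Fin k) : Set (Fin k → ℝ) :=
  {y | y ∈ separatedTuples k n ∧ ∀ i, 0 ≤ y i - y i₀ ∧ y i - y i₀ < n}

/-- For `i ≠ i₀` the normalization is a pair of sign conditions, with `N = 0` and `N = 1`, and these
are constant on chambers. -/
theorem chamber_subset_normalizedTuples {y : Fin k → ℝ} (hy : y ∈ normalizedTuples n i₀) :
    chamber n y ⊆ normalizedTuples n i₀ := by
  refine fun z hz => ⟨chamber_subset hy.1 hz, fun i => ?_⟩
  rcases eq_or_ne i i₀ with rfl | hi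
  · have := hy.2 i
    simp only [sub_self] at this ⊢
    exact this
  · have h1 := hy.2 i
    constructor
    · rcases chamber_dichotomy hy.1 hz hi 0 with h | h
      · have := h.2
        push_cast at this
        linarith
      · have := h.1
        push_cast at this
        linarith
    · rcases chamber_dichotomy hy.1 hz hi 1 with h | h
      · have := h.1
        push_cast at this
        linarith
      · have := h.2
        push_cast at this
        linarith

/-- The projection to the configuration space. -/
def normProj (n : ℕ) (i₀ : Fin k) (y : normalizedTuples n i₀) : ConfSpace k (cycle n) :=
  confProj k n ⟨y.1, y.2.1⟩

theorem continuous_normProj : Continuous (normProj n i₀) := by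
  refine Continuous.subtype_mk (continuous_pi fun i => ?_) _
  exact (AddCircle.continuous_mk' _).comp ((continuous_apply i).comp continuous_subtype_val)

theorem normProj_surjective (hn : 0 < n) : Function.Surjective (normProj n i₀) := by
  intro x
  obtain ⟨y, rfl⟩ := confProj_surjective k n x
  have hn' : (0 : ℝ) < n := by exact_mod_cast hn
  -- Relative to the fixed entry `i₀`, this makes each difference `n` times a fractional part.
  let z : Fin k → ℝ := fun i => y.1 i + n * ((-⌊(y.1 i - y.1 i₀) / n⌋ : ℤ) : ℝ)
  have hz : wrap n z = wrap n y.1 := wrap_add_mul _ _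
  have hzs : z ∈ separatedTuples k n := by
    rw [← wrap_mem_confSpace, hz]
    exact wrap_mem_confSpace.2 y.2
  have hz0 : z i₀ = y.1 i₀ := by simp [z]
  refine ⟨⟨z, hzs, fun i => ?_⟩, Subtype.ext hz⟩
  have h1 : z i - z i₀ = n * Int.fract ((y.1 i - y.1 i₀) / n) := by
    rw [hz0, Int.fract, mul_sub, mul_div_cancel₀ _ hn'.ne']
    simp only [z]
    push_cast
    ring
  rw [h1]
  exact ⟨mul_nonneg hn'.le (Int.fract_nonneg _),
    by simpa using mul_lt_mul_of_pos_left (Int.fract_lt_one ((y.1 i - y.1 i₀) / n)) hn'⟩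

/-! ### The covering map with deck group `ℤ` -/

theorem isOpenMap_wrap : IsOpenMap (wrap n : (Fin k → ℝ) → _) :=
  IsOpenMap.piMap (fun _ => QuotientAddGroup.isOpenMap_coe)
    (Filter.Eventually.of_forall fun _ => QuotientAddGroup.mk_surjective)

theorem mem_chamber_of_dist_lt {y z : Fin k → ℝ} (hy : y ∈ separatedTuples k n)
    (hz : z ∈ separatedTuples k n) (h : dist z y < 1 / 2) : z ∈ chamber n y :=
  mem_chamber_of_abs_sub_lt hy hz fun i => (dist_le_pi_dist z y i).trans_lt h

/-- Separated tuples within 1/2 of a normalized one share its chamber and are normalized too, so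
openness is inherited from `wrap`. -/
theorem isOpenMap_normProj : IsOpenMap (normProj n i₀) := by
  rintro _ ⟨O, hO, rfl⟩
  rw [isOpen_iff_mem_nhds]
  rintro _ ⟨y, hy, rfl⟩
  have hV : IsOpen (wrap n '' (O ∩ Metric.ball y.1 (1 / 2))) :=
    isOpenMap_wrap _ (hO.inter Metric.isOpen_ball)
  refine Filter.mem_of_superset ((hV.preimage continuous_subtype_val).mem_nhds
    ⟨y.1, ⟨hy, Metric.mem_ball_self (by norm_num)⟩, rfl⟩) ?_
  rintro x ⟨z, ⟨hzO, hzy⟩, hzx⟩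
  have hz : z ∈ separatedTuples k n := by
    rw [← wrap_mem_confSpace, hzx]
    exact x.2
  exact ⟨⟨z, chamber_subset_normalizedTuples y.2 (mem_chamber_of_dist_lt y.2.1 hz hzy)⟩, hzO,
    Subtype.ext hzx⟩

/-- `n (N i - N i₀)` is a difference of two numbers in `[0, n)`, hence zero: only diagonal
translations remain. -/
theorem normProj_eq_iff (hn : 0 < n) {y z : normalizedTuples n i₀} :
    normProj n i₀ y = normProj n i₀ z ↔ ∃ c : ℤ, ∀ i, y.1 i = z.1 i + n * c := by
  have hn' : (0 : ℝ) < n := by exact_mod_cast hn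
  refine confProj_eq_iff.trans ⟨fun ⟨N, hN⟩ => ⟨N i₀, fun i => ?_⟩, fun ⟨c, hc⟩ => ⟨fun _ => c, hc⟩⟩
  have h1 := y.2.2 i
  have h2 := z.2.2 i
  have h3 := hN i
  have h4 := hN i₀
  simp only at h3 h4
  have h5 : (n : ℝ) * ((N i - N i₀ : ℤ) : ℝ) = (y.1 i - y.1 i₀) - (z.1 i - z.1 i₀) := by
    push_cast
    linarith
  have h6 : ((N i - N i₀ : ℤ) : ℝ) < 1 := by
    by_contra h
    have := mul_le_mul_of_nonneg_left (not_lt.1 h) hn'.le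
    linarith
  have h7 : (-1 : ℝ) < ((N i - N i₀ : ℤ) : ℝ) := by
    by_contra h
    have := mul_le_mul_of_nonneg_left (not_lt.1 h) hn'.le
    linarith
  have h8 : N i - N i₀ < 1 := by exact_mod_cast h6
  have h9 : -1 < N i - N i₀ := by exact_mod_cast h7
  rw [h3, show N i = N i₀ by omega]

theorem add_const_mem_normalizedTuples {y : Fin k → ℝ} (hy : y ∈ normalizedTuples n i₀) (c : ℝ) :
    (fun i => c + y i) ∈ normalizedTuples n i₀ := by
  refine ⟨fun i j hij N => ?_, fun i => ?_⟩
  · simp only [add_sub_add_left_eq_sub]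
    exact hy.1 i j hij N
  · simp only [add_sub_add_left_eq_sub]
    exact hy.2 i

/-- The translations along the diagonal by multiples of `n`. -/
instance normalizedTuples.addAction (n : ℕ) (i₀ : Fin k) :
    AddAction ℤ (normalizedTuples n i₀) where
  vadd c y := ⟨fun i => (n * c : ℝ) + y.1 i, add_const_mem_normalizedTuples y.2 _⟩
  zero_vadd y := Subtype.ext (funext fun i => by
    change (n * (0 : ℤ) : ℝ) + y.1 i = _
    simp)
  add_vadd a b y := Subtype.ext (funext fun i => by
    change (n * (a + b : ℤ) : ℝ) + y.1 i = n * a + (n * b + y.1 i)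
    push_cast
    ring)

theorem normalizedTuples_vadd_apply (c : ℤ) (y : normalizedTuples n i₀) (i) :
    (c +ᵥ y).1 i = n * c + y.1 i := rfl

theorem isCoveringMap_normProj (hn : 0 < n) (i₀ : Fin k) : IsCoveringMap (normProj n i₀) := by
  have hn' : (1 : ℝ) ≤ n := by exact_mod_cast hn
  refine IsAddQuotientCoveringMap.isCoveringMap _ ℤ ⟨isOpenMap_normProj.isQuotientMap
    continuous_normProj (normProj_surjective hn), ⟨fun c => ?_⟩, fun {y z} => ?_, fun y => ?_⟩
  · refine Continuous.subtype_mk (continuous_pi fun i => ?_) _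
    exact continuous_const.add ((continuous_apply i).comp continuous_subtype_val)
  · rw [normProj_eq_iff hn]
    refine exists_congr fun c => ?_
    rw [Subtype.ext_iff, funext_iff]
    refine forall_congr' fun i => ?_
    simp only [normalizedTuples_vadd_apply]
    rw [add_comm, eq_comm]
  · refine ⟨Metric.ball y (1 / 2), Metric.ball_mem_nhds _ (by norm_num), fun c => ?_⟩
    rintro ⟨_, ⟨z, hz, rfl⟩, hz'⟩
    have h1 : |z.1 i₀ - y.1 i₀| < 1 / 2 := (dist_le_pi_dist z.1 y.1 i₀).trans_lt hz
    have h2 : |n * c + z.1 i₀ - y.1 i₀| < 1 / 2 :=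
      (dist_le_pi_dist (c +ᵥ z).1 y.1 i₀).trans_lt hz'
    rw [abs_lt] at h1 h2
    by_contra hc
    have h3 : (1 : ℝ) ≤ |(c : ℝ)| := by exact_mod_cast Int.one_le_abs hc
    have h4 : 1 ≤ |(n : ℝ) * c| := by
      rw [abs_mul, abs_of_nonneg (by linarith : (0 : ℝ) ≤ n)]
      exact one_le_mul_of_one_le_of_one_le hn' h3
    have h5 : |(n : ℝ) * c| < 1 := abs_lt.2 ⟨by linarith, by linarith⟩
    linarith

/-- A ball of radius at most 1/2 meets only the chamber of its centre, in a convex set. -/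
instance normalizedTuples.locallyPathConnectedSpace (n : ℕ) (i₀ : Fin k) :
    LocallyPathConnectedSpace (normalizedTuples n i₀) := by
  refine .of_bases (p := fun _ r => 0 < r ∧ r ≤ 1 / 2) (s := fun y r => Metric.ball y r)
    (fun y => Metric.nhds_basis_ball.restrict fun r hr =>
      ⟨min r (1 / 2), lt_min hr (by norm_num), min_le_right _ _,
        Metric.ball_subset_ball (min_le_left _ _)⟩) fun y r hr => ?_
  rw [IsInducing.subtypeVal.isPathConnected_iff]
  have : Subtype.val '' Metric.ball y r = Metric.ball y.1 r ∩ chamber n y.1 := by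
    ext z
    constructor
    · rintro ⟨z, hz, rfl⟩
      exact ⟨hz, mem_chamber_of_dist_lt y.2.1 z.2.1 (lt_of_lt_of_le hz hr.2)⟩
    · rintro ⟨hz, hzy⟩
      exact ⟨⟨z, chamber_subset_normalizedTuples y.2 hzy⟩, hz, rfl⟩
  rw [this]
  exact ((convex_ball _ _).inter (convex_chamber n y.1)).isPathConnected
    ⟨y.1, Metric.mem_ball_self hr.1, mem_chamber_self y.2.1⟩

/-! ### Connected components are chambers -/

theorem isOpen_setOf_mem_chamber (y : normalizedTuples n i₀) :
    IsOpen {z : normalizedTuples n i₀ | z.1 ∈ chamber n y.1} := by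
  refine Metric.isOpen_iff.2 fun z hz => ⟨1 / 2, by norm_num, fun w hw => ?_⟩
  have := mem_chamber_of_dist_lt z.2.1 w.2.1 hw
  rwa [chamber_eq y.2.1 hz] at this

theorem isOpen_setOf_notMem_chamber (y : normalizedTuples n i₀) :
    IsOpen {z : normalizedTuples n i₀ | z.1 ∉ chamber n y.1} := by
  refine Metric.isOpen_iff.2 fun z hz => ⟨1 / 2, by norm_num, fun w hw hwy => hz ?_⟩
  have h1 := mem_chamber_of_dist_lt z.2.1 w.2.1 hw
  rw [← chamber_eq y.2.1 hwy, chamber_eq z.2.1 h1]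
  exact mem_chamber_self z.2.1

/-- The chamber of `y`, as a set of normalized tuples, is homeomorphic to a convex set. -/
def chamberHomeomorph (y : normalizedTuples n i₀) :
    {z : normalizedTuples n i₀ | z.1 ∈ chamber n y.1} ≃ₜ chamber n y.1 where
  toFun z := ⟨z.1.1, z.2⟩
  invFun z := ⟨⟨z.1, chamber_subset_normalizedTuples y.2 z.2⟩, z.2⟩
  left_inv _ := rfl
  right_inv _ := rfl
  continuous_toFun := by fun_prop
  continuous_invFun := by fun_prop

theorem contractibleSpace_chamber (y : normalizedTuples n i₀) :
    ContractibleSpace {z : normalizedTuples n i₀ | z.1 ∈ chamber n y.1} :=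
  have := (convex_chamber n y.1).contractibleSpace ⟨y.1, mem_chamber_self y.2.1⟩
  (chamberHomeomorph y).contractibleSpace

theorem isPreconnected_setOf_mem_chamber (y : normalizedTuples n i₀) :
    IsPreconnected {z : normalizedTuples n i₀ | z.1 ∈ chamber n y.1} := by
  have := contractibleSpace_chamber y
  exact isPreconnected_iff_preconnectedSpace.2 inferInstance

theorem connectedComponent_eq_chamber (y : normalizedTuples n i₀) :
    connectedComponent y = {z | z.1 ∈ chamber n y.1} :=
  subset_antisymm
    (IsClopen.connectedComponent_subset
      ⟨⟨isOpen_setOf_notMem_chamber y⟩, isOpen_setOf_mem_chamber y⟩ (mem_chamber_self y.2.1))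
    ((isPreconnected_setOf_mem_chamber y).subset_connectedComponent (mem_chamber_self y.2.1))

/-- Diagonal translations do not change differences, so chambers are unions of fibres. This is what
the normalization achieves. -/
theorem mem_chamber_of_normProj_eq (hn : 0 < n) {y z w : normalizedTuples n i₀}
    (h : normProj n i₀ z = normProj n i₀ w) (hz : z.1 ∈ chamber n y.1) : w.1 ∈ chamber n y.1 := by
  obtain ⟨c, hc⟩ := (normProj_eq_iff hn).1 h
  refine mem_chamber.2 fun i j hij N hN => ?_
  have := mem_chamber.1 hz i j hij N hN
  rw [hc i, hc j] at this
  linarith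

/-- As chambers are saturated, the complement of the image of a chamber is the image of the
complement, and both are open. -/
theorem preimage_connectedComponent_normProj (hn : 0 < n) (y : normalizedTuples n i₀) :
    normProj n i₀ ⁻¹' connectedComponent (normProj n i₀ y) = {z | z.1 ∈ chamber n y.1} := by
  set A : Set (normalizedTuples n i₀) := {z | z.1 ∈ chamber n y.1} with hA
  have hcompl : (normProj n i₀ '' A)ᶜ = normProj n i₀ '' {z | z.1 ∉ chamber n y.1} := by
    ext x
    obtain ⟨z, rfl⟩ := normProj_surjective (i₀ := i₀) hn x
    constructor
    · exact fun h => ⟨z, fun hz => h ⟨z, hz, rfl⟩, rfl⟩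
    · rintro ⟨w, hw, hwz⟩ ⟨z', hz', hz'z⟩
      exact hw (mem_chamber_of_normProj_eq hn (hz'z.trans hwz.symm) hz')
  have hclopen : IsClopen (normProj n i₀ '' A) := by
    refine ⟨⟨?_⟩, isOpenMap_normProj _ (isOpen_setOf_mem_chamber y)⟩
    rw [hcompl]
    exact isOpenMap_normProj _ (isOpen_setOf_notMem_chamber y)
  have hyA : y ∈ A := mem_chamber_self y.2.1
  apply subset_antisymm
  · intro z hz
    obtain ⟨w, hw, hwz⟩ := hclopen.connectedComponent_subset ⟨y, hyA, rfl⟩ hz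
    exact mem_chamber_of_normProj_eq hn hwz hw
  · intro z hz
    exact ((isPreconnected_setOf_mem_chamber y).image _
      continuous_normProj.continuousOn).subset_connectedComponent ⟨y, hyA, rfl⟩ ⟨z, hz, rfl⟩

theorem isUniversalCover_normProj (hn : 0 < n) (i₀ : Fin k) :
    IsUniversalCover (normProj n i₀) := by
  refine ⟨isCoveringMap_normProj hn i₀, fun x => ?_⟩
  obtain ⟨y, rfl⟩ := normProj_surjective (i₀ := i₀) hn x
  rw [preimage_connectedComponent_normProj hn]
  have := contractibleSpace_chamber y
  infer_instance

theorem locallyPathConnectedSpace_confSpace (hn : 0 < n) (i₀ : Fin k) :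
    LocallyPathConnectedSpace (ConfSpace k (cycle n)) :=
  (isOpenMap_normProj (i₀ := i₀).isQuotientMap continuous_normProj
    (normProj_surjective hn)).locallyPathConnectedSpace

/-! ### Uniqueness of universal covers -/

theorem IsLocalHomeomorph.locallyPathConnectedSpace {E : Type u} {X : Type v} [TopologicalSpace E]
    [TopologicalSpace X] [LocallyPathConnectedSpace X] {q : E → X} (hq : IsLocalHomeomorph q) :
    LocallyPathConnectedSpace E := by
  choose f hf _ using hq
  let _ : ChartedSpace X E :=
    { atlas := Set.univ, chartAt := f, mem_chart_source := hf, chart_mem_atlas := fun _ => trivial }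
  exact ChartedSpace.locallyPathConnectedSpace X E

/-- Simply connected components of coverings over a common point are isomorphic. -/
theorem IsCoveringMap.exists_homeomorph_connectedComponent {E : Type u} {F : Type v} {X : Type*}
    [TopologicalSpace E] [TopologicalSpace F] [TopologicalSpace X] [LocallyPathConnectedSpace E]
    [LocallyPathConnectedSpace F] {p : E → X} {q : F → X} (hp : IsCoveringMap p)
    (hq : IsCoveringMap q) {e : E} {f : F} (hef : p e = q f)
    (he : SimplyConnectedSpace (connectedComponent e))
    (hf : SimplyConnectedSpace (connectedComponent f)) :
    ∃ h : connectedComponent e ≃ₜ connectedComponent f, ∀ a, q (h a).1 = p a.1 := by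
  have hE : LocallyPathConnectedSpace (connectedComponent e) :=
    isOpen_connectedComponent.locallyPathConnectedSpace
  have hF : LocallyPathConnectedSpace (connectedComponent f) :=
    isOpen_connectedComponent.locallyPathConnectedSpace
  let e' : connectedComponent e := ⟨e, mem_connectedComponent⟩
  let f' : connectedComponent f := ⟨f, mem_connectedComponent⟩
  -- The lifting criterion gives maps in both directions; their composites are lifts agreeing with
  -- the inclusions at the base points.
  obtain ⟨G, ⟨hGe, hG⟩, -⟩ := hq.existsUnique_continuousMap_lifts
    ⟨fun a : connectedComponent e => p a.1, hp.continuous.comp continuous_subtype_val⟩ e' f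
    hef.symm
  obtain ⟨H, ⟨hHf, hH⟩, -⟩ := hp.existsUnique_continuousMap_lifts
    ⟨fun a : connectedComponent f => q a.1, hq.continuous.comp continuous_subtype_val⟩ f' e hef
  have hGm (a) : G a ∈ connectedComponent f :=
    (isPreconnected_range G.continuous).subset_connectedComponent ⟨e', hGe⟩ ⟨a, rfl⟩
  have hHm (a) : H a ∈ connectedComponent e :=
    (isPreconnected_range H.continuous).subset_connectedComponent ⟨f', hHf⟩ ⟨a, rfl⟩
  have hG' (a) : q (G a) = p a.1 := congrFun hG a
  have hH' (a) : p (H a) = q a.1 := congrFun hH a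
  have hGc : Continuous fun a => (⟨G a, hGm a⟩ : connectedComponent f) := by fun_prop
  have hHc : Continuous fun a => (⟨H a, hHm a⟩ : connectedComponent e) := by fun_prop
  have hHG : (fun a => H ⟨G a, hGm a⟩) = Subtype.val :=
    hp.eq_of_comp_eq (H.continuous.comp hGc) continuous_subtype_val
      (funext fun a => (hH' _).trans (hG' a)) e'
      ((congrArg H (Subtype.ext hGe : (⟨G e', hGm e'⟩ : connectedComponent f) = f')).trans hHf)
  have hGH : (fun a => G ⟨H a, hHm a⟩) = Subtype.val :=
    hq.eq_of_comp_eq (G.continuous.comp hHc) continuous_subtype_val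
      (funext fun a => (hG' _).trans (hH' a)) f'
      ((congrArg G (Subtype.ext hHf : (⟨H f', hHm f'⟩ : connectedComponent e) = e')).trans hGe)
  exact ⟨{  toFun := fun a => ⟨G a, hGm a⟩
            invFun := fun a => ⟨H a, hHm a⟩
            left_inv := fun a => Subtype.ext (congrFun hHG a)
            right_inv := fun a => Subtype.ext (congrFun hGH a)
            continuous_toFun := hGc
            continuous_invFun := hHc }, hG'⟩

/-- The preimage of the component of `q e` is connected, so it is exactly the component of `e`. -/
theorem IsUniversalCover.simplyConnectedSpace {E : Type u} {X : Type v} [TopologicalSpace E]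
    [TopologicalSpace X] {q : E → X} (hq : IsUniversalCover q) (e : E) :
    SimplyConnectedSpace (connectedComponent e) := by
  have h := hq.2 (q e)
  have : connectedComponent e = q ⁻¹' connectedComponent (q e) := by
    refine subset_antisymm ?_ ?_
    · rw [← Set.image_subset_iff]
      exact (isPreconnected_connectedComponent.image q
        hq.1.continuous.continuousOn).subset_connectedComponent ⟨e, mem_connectedComponent, rfl⟩
    · exact (isPreconnected_iff_preconnectedSpace.2 inferInstance).subset_connectedComponent
        mem_connectedComponent
  rw [this]
  exact h

end Covering

section Main

variable {k m n : ℕ} {i₀ : Fin k}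

/-! ### Chambers and the column -/

/-- Sort the entries. Separation with `N = 0` makes the gaps at least 1, and with `N = 1` it
improves the spread from below `n` to at most `n - 1`. -/
theorem exists_perm_mem_columnBounds {y : Fin k → ℝ} (hy : y ∈ normalizedTuples n i₀) :
    ∃ π : Equiv.Perm (Fin k), y ∘ π ∈ diffPolyhedron (columnBounds k n) := by
  have hn : (0 : ℝ) < n := by simpa using (hy.2 i₀).2
  have hn1 : (1 : ℝ) ≤ n := by
    have : 0 < n := by exact_mod_cast hn
    exact_mod_cast this
  refine ⟨Tuple.sort y, mem_diffPolyhedron_columnBounds.2 ⟨fun i j hij => ?_, fun i j => ?_⟩⟩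
  · have h1 := Tuple.monotone_sort y hij.le
    have h2 := hy.1 (Tuple.sort y j) (Tuple.sort y i)
      (fun h => hij.ne ((Tuple.sort y).injective h).symm) 0
    simp only [Function.comp] at h1 ⊢
    rw [Int.cast_zero, mul_zero, sub_zero, abs_of_nonneg (sub_nonneg.2 h1)] at h2
    exact h2
  · simp only [Function.comp]
    rcases eq_or_ne (Tuple.sort y i) (Tuple.sort y j) with h | h
    · rw [h]
      linarith
    · have h1 := hy.2 (Tuple.sort y i)
      have h2 := hy.2 (Tuple.sort y j)
      have h3 := hy.1 _ _ h.symm 1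
      rw [Int.cast_one, mul_one, abs_of_neg (by linarith)] at h3
      linarith

theorem chamber_eq_columnBounds (hn : 0 < n) {w : Fin k → ℝ}
    (hw : w ∈ diffPolyhedron (columnBounds k n)) :
    chamber n w = diffPolyhedron (columnBounds k n) := by
  have hn1 : (1 : ℝ) ≤ n := by exact_mod_cast hn
  rw [mem_diffPolyhedron_columnBounds] at hw
  ext z
  rw [mem_diffPolyhedron_columnBounds, mem_chamber]
  constructor
  · intro h
    refine ⟨fun i j hij => ?_, fun i j => ?_⟩
    · have h1 := hw.1 i j hij
      have h2 := h j i hij.ne' 0 (by push_cast; linarith)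
      push_cast at h2
      linarith
    · rcases eq_or_ne i j with rfl | hij
      · linarith
      · have h1 := hw.2 i j
        have h2 := h i j hij (-1) (by push_cast; linarith)
        push_cast at h2
        linarith
  · rintro ⟨h1, h2⟩ i j hij N hN
    -- For `N < 0` the spread bound suffices, `N = 0` is the order of the entries, and for `N > 0`
    -- the premise `hN` contradicts the spread of `w`.
    rcases lt_trichotomy N 0 with hN0 | rfl | hN0
    · have h3 : (N : ℝ) ≤ -1 := by exact_mod_cast (by omega : N ≤ -1)
      have h4 := mul_le_mul_of_nonneg_left h3 (by linarith : (0 : ℝ) ≤ n)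
      have h5 := h2 i j
      linarith
    · push_cast at hN ⊢
      rcases lt_or_gt_of_ne hij with h | h
      · have := hw.1 i j h
        linarith
      · have := h1 j i h
        linarith
    · have h3 : (1 : ℝ) ≤ N := by exact_mod_cast hN0
      have h4 := mul_le_mul_of_nonneg_left h3 (by linarith : (0 : ℝ) ≤ n)
      have h5 := hw.2 j i
      linarith

theorem comp_perm_mem_chamber {y z : Fin k → ℝ} (π : Equiv.Perm (Fin k)) :
    z ∘ π ∈ chamber n (y ∘ π) ↔ z ∈ chamber n y := by
  rw [mem_chamber, mem_chamber]
  constructor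
  · intro h i j hij N hN
    have := h (π.symm i) (π.symm j) (fun h => hij (π.symm.injective h)) N
    simp only [Function.comp, Equiv.apply_symm_apply] at this
    exact this hN
  · intro h i j hij N hN
    exact h (π i) (π j) (fun h => hij (π.injective h)) N hN

/-- The connected component of a normalized tuple is homeomorphic to the column, by a permutation
of the coordinates. -/
theorem exists_homeomorph_column (hn : 0 < n) (y : normalizedTuples n i₀) :
    ∃ (π : Equiv.Perm (Fin k)) (h : connectedComponent y ≃ₜ ColumnSpace k n),
      ∀ a, (h a).1 = a.1.1 ∘ π := by
  obtain ⟨π, hπ⟩ := exists_perm_mem_columnBounds y.2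
  have key (z : Fin k → ℝ) :
      z ∈ chamber n y.1 ↔ z ∘ π ∈ (line.prod k).support (InColumn k n) := by
    rw [support_inColumn, ← chamber_eq_columnBounds hn hπ, comp_perm_mem_chamber]
  have hcc := connectedComponent_eq_chamber y
  have hto (a : connectedComponent y) : a.1.1 ∘ π ∈ (line.prod k).support (InColumn k n) :=
    (key _).1 (hcc.le a.2)
  have hinv (c : ColumnSpace k n) : c.1 ∘ π.symm ∈ chamber n y.1 := by
    rw [key, Function.comp_assoc, Equiv.symm_comp_self, Function.comp_id]
    exact c.2
  refine ⟨π, ⟨⟨fun a => ⟨a.1.1 ∘ π, hto a⟩,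
    fun c => ⟨⟨c.1 ∘ π.symm, chamber_subset_normalizedTuples y.2 (hinv c)⟩, hcc.ge (hinv c)⟩,
    fun a => ?_, fun c => ?_⟩, ?_, ?_⟩, fun a => rfl⟩
  · refine Subtype.ext (Subtype.ext ?_)
    simp only [Function.comp_assoc, Equiv.self_comp_symm, Function.comp_id]
  · refine Subtype.ext ?_
    simp only [Function.comp_assoc, Equiv.symm_comp_self, Function.comp_id]
  · refine Continuous.subtype_mk (continuous_pi fun i => ?_) _
    exact (continuous_apply (π i)).comp (continuous_subtype_val.comp continuous_subtype_val)
  · refine Continuous.subtype_mk (Continuous.subtype_mk (continuous_pi fun i => ?_) _) _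
    exact (continuous_apply (π.symm i)).comp continuous_subtype_val

/-! ### Components of universal covers -/

theorem continuous_of_mem_column_cells {σ : OrthoCell (ColumnSpace k n) m}
    (hσ : σ ∈ (column k n).cells m) : Continuous σ.toFun := by
  obtain ⟨v, hv, h⟩ := mem_column_cells.1 hσ
  rw [Topology.IsInducing.subtypeVal.continuous_iff]
  have := continuous_latticeCell v
  rw [← h] at this
  exact this

theorem latticeCell_perm_apply (v : Fin (m + 1) → Fin k → ℤ) (π : Equiv.Perm (Fin k)) (t) :
    (latticeCell fun j i => v j (π i) + 0).toFun t = (latticeCell v).toFun t ∘ π := by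
  funext i
  rw [latticeCell_transform_apply v π fun _ => 0]
  simp

/-- The isomorphism is the comparison with the chamber cover followed by a permutation of
coordinates. Simplices correspond because both sides lift the same simplices downstairs. -/
theorem isIsomorphic_column {E : Type u} [TopologicalSpace E] (hk : 0 < k) (hn : 0 < n)
    (q : E → ConfSpace k (cycle n)) (hq : IsUniversalCover q) (e : E) :
    (((conf k (cycle n)).lift q).restrict (connectedComponent e)).IsIsomorphic (column k n) := by
  have i₀ : Fin k := ⟨0, hk⟩
  have := locallyPathConnectedSpace_confSpace hn i₀
  have := hq.1.isLocalHomeomorph.locallyPathConnectedSpace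
  obtain ⟨y, hy⟩ := normProj_surjective (i₀ := i₀) hn (q e)
  have hcov := isUniversalCover_normProj hn i₀
  obtain ⟨h, hh⟩ := hq.1.exists_homeomorph_connectedComponent hcov.1 hy.symm
    (hq.simplyConnectedSpace e) (hcov.simplyConnectedSpace y)
  obtain ⟨π, g, hg⟩ := exists_homeomorph_column hn y
  refine ⟨h.trans g, fun m σ => ⟨?_, fun hσ => ?_⟩⟩
  · rintro ⟨hcont, hcell⟩
    change Continuous (fun t => (σ.toFun t).1) at hcont
    have hcont' : Continuous σ.toFun := by
      rw [Topology.IsInducing.subtypeVal.continuous_iff]; exact hcont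
    let t₀ : stdSimplex ℝ (Fin (m + 1)) := stdSimplex.vertex 0
    obtain ⟨v, hv, hvt, hs, hσv⟩ := exists_lift_of_mem_conf_cells hcell (t := t₀)
      (y := ⟨(h (σ.toFun t₀)).1.1, (h (σ.toFun t₀)).1.2.1⟩) (hh (σ.toFun t₀))
    have hvn (t) : (latticeCell v).toFun t ∈ normalizedTuples n i₀ := by
      refine chamber_subset_normalizedTuples (h (σ.toFun t₀)).1.2 ?_
      have := chamber_latticeCell hv hs t₀ t
      rwa [hvt] at this
    -- Two continuous lifts of the same simplex that agree at the vertex `t₀` agree everywhere, so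
    -- the given lift is affine.
    have heq : (fun t => (h (σ.toFun t)).1) = fun t => ⟨(latticeCell v).toFun t, hvn t⟩ := by
      refine hcov.1.eq_of_comp_eq
        (continuous_subtype_val.comp (h.continuous.comp hcont'))
        (Continuous.subtype_mk (continuous_latticeCell v) _) (funext fun t => ?_) t₀
        (Subtype.ext hvt.symm)
      exact (hh (σ.toFun t)).trans (congrFun (congrArg OrthoCell.toFun hσv) t)
    refine mem_column_cells.2 ⟨_, hv.transform π fun _ => 0, ?_⟩
    ext1
    · funext t
      rw [latticeCell_perm_apply]
      have h1 : (h (σ.toFun t)).1.1 = (latticeCell v).toFun t :=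
        congrArg Subtype.val (congrFun heq t)
      rw [← h1]
      exact hg _
    · rw [latticeCell_transform_len v π fun _ => 0]
      exact (OrthoCell.mk.inj hσv).2
  · have hcont := continuous_of_mem_column_cells hσ
    have hcont' : Continuous σ.toFun := by
      have := (h.trans g).symm.continuous.comp hcont
      refine this.congr fun t => ?_
      exact (h.trans g).symm_apply_apply (σ.toFun t)
    obtain ⟨v, hv, hσv⟩ := mem_column_cells.1 hσ
    refine ⟨continuous_subtype_val.comp hcont', ?_⟩
    have h1 (t) : (h (σ.toFun t)).1.1 =
        (latticeCell fun j i => v j (π.symm i) + 0).toFun t := by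
      rw [latticeCell_perm_apply, ← hσv]
      change _ = (g (h (σ.toFun t))).1 ∘ π.symm
      rw [hg, Function.comp_assoc, Equiv.self_comp_symm, Function.comp_id]
    have hs (t) : (latticeCell fun j i => v j (π.symm i) + 0).toFun t ∈ separatedTuples k n := by
      rw [← h1]
      exact (h (σ.toFun t)).1.2.1
    convert mem_conf_cells (hv.transform π.symm fun _ => 0) hs using 1
    ext1
    · funext t
      refine (hh (σ.toFun t)).symm.trans ?_
      exact congrArg (confProj k n) (Subtype.ext (h1 t))
    · rw [latticeCell_transform_len v π.symm fun _ => 0]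
      exact congrArg OrthoCell.len hσv

/-! ### Curvature of the column, the covers and the configuration spaces -/

theorem OrthoSystem.IsIsomorphic.exists_edist_eq {K : Type u} {L : Type v} [TopologicalSpace K]
    [TopologicalSpace L] {S : OrthoSystem K} {T : OrthoSystem L} (h : S.IsIsomorphic T) :
    ∃ e : K ≃ L, ∀ x y, S.edist x y = T.edist (e x) (e y) := by
  obtain ⟨e, he⟩ := h
  refine ⟨e.toEquiv, fun x y => ?_⟩
  have h1 {x y ℓ} (hp : S.HasPath x y ℓ) : T.HasPath (e x) (e y) ℓ := by
    induction hp with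
    | refl => exact .refl _
    | step σ hσ a b _ ih => exact ih.step (S := T) (σ.map e) ((he _ σ).1 hσ) a b
  have h2 {x y ℓ} (hp : T.HasPath x y ℓ) : S.HasPath (e.symm x) (e.symm y) ℓ := by
    induction hp with
    | refl => exact .refl _
    | step σ hσ a b _ ih =>
      refine ih.step (S := S) (σ.map e.symm) ((he _ _).2 ?_) a b
      convert hσ using 1
      ext1
      · funext t
        exact e.apply_symm_apply _
      · rfl
  refine le_antisymm (le_iInf₂ fun ℓ hp => iInf₂_le ℓ ?_) (le_iInf₂ fun ℓ hp => iInf₂_le ℓ (h1 hp))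
  have := h2 hp
  simpa using this

theorem convex_range_column (k n : ℕ) :
    Convex ℝ (Set.range fun x : ColumnSpace k n => WithLp.toLp 2 x.1) := by
  have : Set.range (fun x : ColumnSpace k n => WithLp.toLp 2 x.1) =
      (WithLp.linearEquiv 2 ℝ (Fin k → ℝ)).symm '' diffPolyhedron (columnBounds k n) := by
    rw [← support_inColumn]
    ext v
    constructor
    · rintro ⟨x, rfl⟩
      exact ⟨x.1, x.2, rfl⟩
    · rintro ⟨x, hx, rfl⟩
      exact ⟨⟨x, hx⟩, rfl⟩
  rw [this]
  exact (convex_diffPolyhedron _).linear_image (WithLp.linearEquiv 2 ℝ (Fin k → ℝ)).symm.toLinearMap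

theorem toLp_val_injective {A : Set (Fin k → ℝ)} :
    Function.Injective fun x : A => (WithLp.toLp 2 x.1 : EuclideanSpace ℝ (Fin k)) :=
  fun _ _ h => Subtype.ext (WithLp.toLp_injective 2 h)

theorem column_isCAT0 (k n : ℕ) : IsCAT0 (column k n).edist :=
  isCAT0_of_convex_range _ toLp_val_injective (convex_range_column k n) column_edist

theorem isCAT0_of_isIsomorphic_column {K : Type u} [TopologicalSpace K] {S : OrthoSystem K}
    (h : S.IsIsomorphic (column k n)) : IsCAT0 S.edist := by
  obtain ⟨e, he⟩ := h.exists_edist_eq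
  refine isCAT0_of_convex_range (fun x => WithLp.toLp 2 (e x).1)
    (toLp_val_injective.comp e.injective) ?_ fun x y => by rw [he, column_edist]
  have := convex_range_column k n
  rwa [← e.surjective.range_comp] at this

/-- Separated tuples in the same chamber. -/
def chamberSetoid (k n : ℕ) : Setoid (separatedTuples k n) where
  r y z := z.1 ∈ chamber n y.1
  iseqv :=
    { refl := fun y => mem_chamber_self y.2
      symm := fun {y z} h => by
        rw [chamber_eq y.2 h]
        exact mem_chamber_self y.2
      trans := fun {y z w} h h' => by rwa [chamber_eq y.2 h] at h' }

theorem convex_image_chamber (y : separatedTuples k n) :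
    Convex ℝ ((fun x : separatedTuples k n => (WithLp.toLp 2 x.1 : EuclideanSpace ℝ (Fin k))) ''
      {z | chamberSetoid k n y z}) := by
  have : (fun x : separatedTuples k n => (WithLp.toLp 2 x.1 : EuclideanSpace ℝ (Fin k))) ''
      {z | chamberSetoid k n y z} =
        (WithLp.linearEquiv 2 ℝ (Fin k → ℝ)).symm '' chamber n y.1 := by
    ext v
    constructor
    · rintro ⟨x, hx, rfl⟩
      exact ⟨x.1, hx, rfl⟩
    · rintro ⟨x, hx, rfl⟩
      exact ⟨⟨x, chamber_subset y.2 hx⟩, hx, rfl⟩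
  rw [this]
  exact (convex_chamber n y.1).linear_image (WithLp.linearEquiv 2 ℝ (Fin k → ℝ)).symm.toLinearMap

theorem conf_isNonpositivelyCurved (k : ℕ) (hn : 0 < n) :
    IsNonpositivelyCurved (conf k (cycle n)).edist :=
  isNonpositivelyCurved_of_path_lifting (confProj k n) (confProj_surjective k n) _
    toLp_val_injective (chamberSetoid k n) convex_image_chamber (fun _ _ => conf_hasPath)
    (fun _ _ _ => exists_of_conf_hasPath) one_half_pos (fun _ _ => eq_of_confProj_eq hn)

theorem uconf_isNonpositivelyCurved (k : ℕ) (hn : 0 < n) :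
    IsNonpositivelyCurved (uconf k (cycle n)).edist :=
  isNonpositivelyCurved_of_path_lifting (uconfProj k n) (uconfProj_surjective k n) _
    toLp_val_injective (chamberSetoid k n) convex_image_chamber (fun _ _ => uconf_hasPath)
    (fun _ _ _ => exists_of_uconf_hasPath) one_half_pos (fun _ _ => eq_of_uconfProj_eq hn)

end Main

theorem mainTheorem8 (k n : ℕ) (hk : 0 < k) (hkn : k ≤ n) :
    (column k n).IsOrthoschemeComplex ∧
    (conf k (cycle n)).IsOrthoschemeComplex ∧
    (uconf k (cycle n)).IsOrthoschemeComplex ∧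
    (∃ (E : Type) (_ : TopologicalSpace E) (q : E → ConfSpace k (cycle n)),
      IsUniversalCover q) ∧
    (∀ (E : Type u) [TopologicalSpace E] (q : E → ConfSpace k (cycle n)),
      IsUniversalCover q → ∀ e : E,
        (((conf k (cycle n)).lift q).restrict (connectedComponent e)).IsIsomorphic (column k n) ∧
        IsCAT0 (((conf k (cycle n)).lift q).restrict (connectedComponent e)).edist) ∧
    IsCAT0 (column k n).edist ∧
    IsNonpositivelyCurved (conf k (cycle n)).edist ∧
    IsNonpositivelyCurved (uconf k (cycle n)).edist := by

  have hn : 0 < n := hk.trans_le hkn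
  exact ⟨column_isOrthoschemeComplex k n, conf_isOrthoschemeComplex k n,
    uconf_isOrthoschemeComplex k n, ⟨_, _, _, isUniversalCover_normProj hn ⟨0, hk⟩⟩,
    fun E _ q hq e => ⟨isIsomorphic_column hk hn q hq e,
      isCAT0_of_isIsomorphic_column (isIsomorphic_column hk hn q hq e)⟩,
    column_isCAT0 k n, conf_isNonpositivelyCurved k hn, uconf_isNonpositivelyCurved k hn⟩
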